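/- **Definitions.** Let $E$ be a real vector space of dimension $d$. A triangulated vector configuration $(V,\mathcal T)$ in $E$ is a list $V=(v_1,\dots,v_n)$ of vectors spanning $E$ (repetitions allowed), with an abstract simplicial complex $\mathcal T$ on $\{1,\dots,n\}$ such that, for all $\tau,\tau'\in\mathcal T$, the family $(v_j)_{j\in\tau}$ is linearly independent, $\operatorname{cone}(\tau)\cap\operatorname{cone}(\tau')=\operatorname{cone}(\tau\cap\tau')$, and $\bigcup_{\tau\in\mathcal T}\operatorname{cone}(\tau)\supseteq\operatorname{cone}(V)$. It is *regular* if some full-rank lattice $L\subset E$ contains all $v_j$ and $(v_j)_{j\in\tau}$ is a $\mathbb Z$-basis of $L$ for each $\tau\in\mathcal T$ with $|\tau|=d$; *balanced* if $\sum_j v_j=0$; *odd* if $n-d=2m+1$ for an integer $m\ge 0$. The vector $v_j$ is a *ghost* if $j$ belongs to no $\tau\in\mathcal T$. A *Gale dual configuration* is a real $n\times 2m$ matrix $\Lambda^{\mathbb R}$ whose columns, together with $(1,\dots,1)$, form a basis of $\{c\in\mathbb R^n:\sum_j c_jv_j=0\}$. A *period matrix* is a complex $m\times 2m$ matrix $\Pi$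 whose columns form a real basis of $\mathbb C^m$ (for instance $[P\,|\,I_m]$ with $\det\operatorname{Im}P\ne 0$). Put $\Lambda=\Lambda^{\mathbb R}\,\Pi^{T}$, with rows $\Lambda_1,\dots,\Lambda_n\in\mathbb C^m$, and $U(\mathcal T)=\bigcup_{\tau\in\mathcal T,\,|\tau|=d}\{z\in\mathbb C^n: z_j\neq 0\text{ for all }j\notin\tau\}$. The associated *LVMB manifold* $N$ is the quotient of $\mathbb P(U(\mathcal T))$ by the $\mathbb C^m$-action $u\cdot(z_1:\dots:z_n)=(e^{2\pi i\langle\Lambda_1,u\rangle}z_1:\dots:e^{2\pi i\langle\Lambda_n,u\rangle}z_n)$, with the quotient topology and the complex structure for which $U(\mathcal T)\to N$ is a holomorphic submersion. **Proposition.** Let $(V,\mathcal T)$ be a regular, odd and balanced configuration, with a Gale dual configuration $\Lambda^{\mathbb R}$ and a period matrix $\Pi$, and let $N$ be the corresponding LVMB manifold (a compact complex manifold of dimension $d+m$). Let $(V',\mathcal T')$ be obtained by prepending two ghost vectors $v_1'=v_2'=0$ to $V$, so $V'=(0,0,v_1,\dots,v_n)$ and the simplices are those of $\mathcal T$ with indices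 shifted by $2$; its constants are $n'=n+2$ and $m'=m+1$. Then for every $\tau\in\mathbb C$ with $\operatorname{Im}\tau>0$ there are a Gale dual configuration of $(V',\mathcal T')$ and a period matrix $\Pi'$, of the form $[P'\,|\,I_{m+1}]$ with $\det\operatorname{Im}P'\neq 0$, such that the corresponding LVMB manifold $N'$ (a compact complex manifold of dimension $d+m+1$) is the total space of a holomorphic principal bundle over $N$ with structure group the elliptic curve $\mathbb C/(\mathbb Z+\mathbb Z\tau)$. Moreover, if $(V,\mathcal T)$ contains at least one ghost vector, then $N'$ is biholomorphic to $N\times\mathbb C/(\mathbb Z+\mathbb Z\tau)$. -/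

import Mathlib

open scoped Manifold ContDiff Matrix UpperHalfPlane

noncomputable section

/-! ### Triangulated vector configurations -/

/-- The cone spanned by the vectors `v j`, `j ∈ τ`. -/
def coneOver {E : Type*} [AddCommGroup E] [Module ℝ E] {n : ℕ} (v : Fin n → E)
    (τ : Finset (Fin n)) : Set E :=
  {x | ∃ c : Fin n → ℝ, (∀ j, 0 ≤ c j) ∧ x = ∑ j ∈ τ, c j • v j}

/-- A triangulated vector configuration: a list of vectors spanning `E` (repetitions are allowed),
with an abstract simplicial complex of simplices whose cones form a simplicial fan with
support the cone over all the vectors. -/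
structure TriangulatedConfiguration (E : Type*) [AddCommGroup E] [Module ℝ E] (n : ℕ) where
  v : Fin n → E
  span_eq_top : Submodule.span ℝ (Set.range v) = ⊤
  simplices : Set (Finset (Fin n))
  down_closed : ∀ τ ∈ simplices, ∀ σ ⊆ τ, σ ∈ simplices
  linearIndependent : ∀ τ ∈ simplices, LinearIndependent ℝ (fun j : τ => v j)
  cone_inter : ∀ τ ∈ simplices, ∀ σ ∈ simplices,
    coneOver v τ ∩ coneOver v σ = coneOver v (τ ∩ σ)
  cone_cover : coneOver v Finset.univ ⊆ ⋃ τ ∈ simplices, coneOver v τ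

namespace TriangulatedConfiguration

variable {E : Type*} [AddCommGroup E] [Module ℝ E] {n m : ℕ}

/-- `j` is (the index of) a ghost vector if it belongs to no simplex. -/
def IsGhost (C : TriangulatedConfiguration E n) (j : Fin n) : Prop :=
  ∀ τ ∈ C.simplices, j ∉ τ

def IsBalanced (C : TriangulatedConfiguration E n) : Prop :=
  ∑ j, C.v j = 0

/-- There is a full-rank lattice `L` in `E` (the `ℤ`-span of an `ℝ`-basis) which contains all
the vectors and has, for each simplex `τ` of maximal cardinality `dim E`, the vectors `v j`,
`j ∈ τ`, as a `ℤ`-basis. -/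
def IsRegular (C : TriangulatedConfiguration E n) : Prop :=
  ∃ b : Module.Basis (Fin (Module.finrank ℝ E)) ℝ E,
    (∀ j, C.v j ∈ Submodule.span ℤ (Set.range b)) ∧
    ∀ τ ∈ C.simplices, τ.card = Module.finrank ℝ E →
      LinearIndependent ℤ (fun j : τ => C.v j) ∧
      Submodule.span ℤ (Set.range fun j : τ => C.v j) = Submodule.span ℤ (Set.range b)

/-- The space of linear relations among the vectors. -/
def relations (C : TriangulatedConfiguration E n) : Submodule ℝ (Fin n → ℝ) where
  carrier := {c | ∑ j, c j • C.v j = 0}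
  add_mem' {a b} ha hb := by
    simp only [Set.mem_ofPred_eq] at ha hb
    simp [add_smul, Finset.sum_add_distrib, ha, hb]
  zero_mem' := by simp
  smul_mem' r a ha := by
    simp only [Set.mem_ofPred_eq] at ha
    simp [mul_smul, ← Finset.smul_sum, ha]

/-- `Λ` is (the list of rows of) a Gale dual configuration: the vector `(1, …, 1)` together with
the `2m` columns of `Λ` is a basis of the space of linear relations. The `2m` columns are indexed
by two blocks of size `m`. -/
def IsGaleDual (C : TriangulatedConfiguration E n) (Λ : Matrix (Fin n) (Fin m ⊕ Fin m) ℝ) :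
    Prop :=
  let f : Option (Fin m ⊕ Fin m) → Fin n → ℝ := fun o => o.elim (fun _ => 1) (fun k j => Λ j k)
  LinearIndependent ℝ f ∧ Submodule.span ℝ (Set.range f) = C.relations

/-! ### Adding two ghost vectors -/

/-- The shift of indices by two. -/
def shiftTwo (n : ℕ) : Fin n ↪ Fin (n + 2) :=
  ⟨fun j => j.succ.succ, fun _ _ h => Fin.succ_injective _ (Fin.succ_injective _ h)⟩

@[simp]
theorem shiftTwo_apply (n : ℕ) (j : Fin n) : shiftTwo n j = j.succ.succ := rfl

theorem coneOver_cons_map (v : Fin n → E) (a b : E) (τ : Finset (Fin n)) :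
    coneOver (Fin.cons a (Fin.cons b v : Fin (n + 1) → E) : Fin (n + 2) → E)
      (τ.map (shiftTwo n)) = coneOver v τ := by
  ext x
  constructor
  · rintro ⟨c, hc, rfl⟩
    exact ⟨fun j => c j.succ.succ, fun j => hc _, by simp⟩
  · rintro ⟨c, hc, rfl⟩
    refine ⟨Fin.cons 0 (Fin.cons 0 c : Fin (n + 1) → ℝ), fun j => ?_, by simp⟩
    refine Fin.cases (by simp) (fun j => ?_) j
    refine Fin.cases (by simp) (fun j => ?_) j
    simpa using hc j

/-- The configuration `(0, 0, v₁, …, vₙ)`, with the same simplices up to the shift of indices. -/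
def prependTwoZeros (C : TriangulatedConfiguration E n) : TriangulatedConfiguration E (n + 2) where
  v := Fin.cons 0 (Fin.cons 0 C.v : Fin (n + 1) → E)
  span_eq_top := by
    rw [eq_top_iff, ← C.span_eq_top, Submodule.span_le]
    rintro _ ⟨j, rfl⟩
    exact Submodule.subset_span ⟨j.succ.succ, by simp⟩
  simplices := (fun τ => τ.map (shiftTwo n)) '' C.simplices
  down_closed := by
    rintro _ ⟨τ, hτ, rfl⟩ σ hσ
    obtain ⟨ρ, hρ, rfl⟩ := Finset.subset_map_iff.1 hσ
    exact ⟨ρ, C.down_closed τ hτ ρ hρ, rfl⟩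
  linearIndependent := by
    rintro _ ⟨τ, hτ, rfl⟩
    have h : ∀ x : τ.map (shiftTwo n), ∃ j : τ, x.1 = shiftTwo n j := fun x => by
      obtain ⟨j, hj, hx⟩ := Finset.mem_map.1 x.2
      exact ⟨⟨j, hj⟩, hx.symm⟩
    choose g hg using h
    convert (C.linearIndependent τ hτ).comp g fun x y hxy => Subtype.ext (by rw [hg, hg, hxy])
      using 1
    ext x
    simp [hg x]
  cone_inter := by
    rintro _ ⟨τ, hτ, rfl⟩ _ ⟨σ, hσ, rfl⟩
    simp only [← Finset.map_inter, coneOver_cons_map]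
    exact C.cone_inter τ hτ σ hσ
  cone_cover := by
    rintro x ⟨c, hc, rfl⟩
    have hx : ∑ j, c j • (Fin.cons 0 (Fin.cons 0 C.v : Fin (n + 1) → E) : Fin (n + 2) → E) j
        ∈ coneOver C.v Finset.univ :=
      ⟨fun j => c j.succ.succ, fun j => hc _, by simp [Fin.sum_univ_succ]⟩
    have hx' := C.cone_cover hx
    simp only [Set.mem_iUnion] at hx' ⊢
    obtain ⟨τ, hτ, hxτ⟩ := hx'
    exact ⟨τ.map (shiftTwo n), ⟨τ, hτ, rfl⟩, by rwa [coneOver_cons_map]⟩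

/-! ### The LVMB construction -/

/-- The open set `U ⊆ ℂⁿ` of the points whose coordinates outside some `τ` are all nonzero, where
`τ` is a simplex of maximal cardinality `dim E`. -/
def U (C : TriangulatedConfiguration E n) : TopologicalSpace.Opens (Fin n → ℂ) where
  carrier := ⋃ τ ∈ {τ ∈ C.simplices | τ.card = Module.finrank ℝ E}, ⋂ j ∈ τᶜ, {z | z j ≠ 0}
  is_open' := isOpen_biUnion fun _ _ => isOpen_biInter_finset fun j _ =>
    isOpen_ne_fun (continuous_apply j) continuous_const

/-- `z` and `w` in `U` define points of the projectivization `ℙ(U)` in the same orbit of the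
`ℂᵐ`-action `u • (z₁ : … : zₙ) = (exp(2πi⟨Λ₁, u⟩) z₁ : … : exp(2πi⟨Λₙ, u⟩) zₙ)`. -/
def orbitSetoid (C : TriangulatedConfiguration E n) (Λ : Matrix (Fin n) (Fin m) ℂ) :
    Setoid C.U where
  r z w := ∃ (c : ℂ) (u : Fin m → ℂ), c ≠ 0 ∧
    ∀ j, w.1 j = c * Complex.exp (2 * Real.pi * Complex.I * (Λ j ⬝ᵥ u)) * z.1 j
  iseqv :=
    { refl := fun z => ⟨1, 0, one_ne_zero, by simp⟩
      symm := by
        rintro z w ⟨c, u, hc, h⟩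
        refine ⟨c⁻¹, -u, inv_ne_zero hc, fun j => ?_⟩
        rw [h j, dotProduct_neg, mul_neg, Complex.exp_neg]
        field_simp [Complex.exp_ne_zero]
      trans := by
        rintro z w y ⟨c, u, hc, h⟩ ⟨c', u', hc', h'⟩
        refine ⟨c' * c, u' + u, mul_ne_zero hc' hc, fun j => ?_⟩
        rw [h' j, h j, dotProduct_add, mul_add, Complex.exp_add]
        ring }

/-- The LVMB manifold as a topological space: the quotient of `ℙ(U)` by the `ℂᵐ`-action, that is,
the quotient of `U` by `ℂˣ × ℂᵐ`. -/
def LVMB (C : TriangulatedConfiguration E n) (Λ : Matrix (Fin n) (Fin m) ℂ) : Type :=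
  Quotient (C.orbitSetoid Λ)

instance (C : TriangulatedConfiguration E n) (Λ : Matrix (Fin n) (Fin m) ℂ) :
    TopologicalSpace (C.LVMB Λ) :=
  inferInstanceAs (TopologicalSpace (Quotient (C.orbitSetoid Λ)))

/-- The projection of `U` onto the LVMB manifold. -/
def toLVMB (C : TriangulatedConfiguration E n) (Λ : Matrix (Fin n) (Fin m) ℂ) (z : C.U) :
    C.LVMB Λ :=
  Quotient.mk (C.orbitSetoid Λ) z

/-- The atlas `cN` makes the LVMB manifold a compact (Hausdorff) complex manifold of dimension `k`
whose complex structure is the quotient one, that is, the projection `U → N` is a holomorphic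
submersion: it is holomorphic and has local holomorphic sections through each point of `U`. -/
structure IsComplexStructure (C : TriangulatedConfiguration E n) (Λ : Matrix (Fin n) (Fin m) ℂ)
    {k : ℕ} (cN : ChartedSpace (Fin k → ℂ) (C.LVMB Λ)) : Prop where
  t2Space : T2Space (C.LVMB Λ)
  compactSpace : CompactSpace (C.LVMB Λ)
  isManifold : IsManifold 𝓘(ℂ, Fin k → ℂ) ω (C.LVMB Λ)
  contMDiff_toLVMB : ContMDiff 𝓘(ℂ, Fin n → ℂ) 𝓘(ℂ, Fin k → ℂ) ω (C.toLVMB Λ)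
  exists_local_section : ∀ z : C.U, ∃ (W : Set (C.LVMB Λ)) (s : C.LVMB Λ → C.U),
    IsOpen W ∧ C.toLVMB Λ z ∈ W ∧ ContMDiffOn 𝓘(ℂ, Fin k → ℂ) 𝓘(ℂ, Fin n → ℂ) ω s W ∧
    s (C.toLVMB Λ z) = z ∧ ∀ q ∈ W, C.toLVMB Λ (s q) = q

end TriangulatedConfiguration

/-- A period matrix: a complex `m × 2m` matrix whose `2m` columns form an `ℝ`-basis of `ℂᵐ`. -/
def IsPeriodMatrix {m : ℕ} (Per : Matrix (Fin m) (Fin m ⊕ Fin m) ℂ) : Prop :=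
  LinearIndependent ℝ (fun k i => Per i k)

/-- A period matrix of the form `[P | I]` with `det (Im P) ≠ 0`. -/
def IsNormalizedPeriodMatrix {m : ℕ} (Per : Matrix (Fin m) (Fin m ⊕ Fin m) ℂ) : Prop :=
  ∃ P : Matrix (Fin m) (Fin m) ℂ, (P.map Complex.im).det ≠ 0 ∧ Per = Matrix.fromCols P 1

/-- The complex points `Λ Πᵀ` associated with a Gale dual configuration and a period matrix. -/
def complexPoints {n m : ℕ} (Λ : Matrix (Fin n) (Fin m ⊕ Fin m) ℝ)
    (Per : Matrix (Fin m) (Fin m ⊕ Fin m) ℂ) : Matrix (Fin n) (Fin m) ℂ :=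
  Λ.map Complex.ofReal * Perᵀ

/-! ### Elliptic curves as complex manifolds -/

/-- The lattice `ℤ + ℤτ`. -/
def periodLattice (τ : ℍ) : AddSubgroup ℂ :=
  AddSubgroup.closure {1, (τ : ℂ)}

theorem isDiscrete_periodLattice (τ : ℍ) : IsDiscrete (periodLattice τ : Set ℂ) := by
  have hind : LinearIndependent ℝ ![(1 : ℂ), (τ : ℂ)] := by
    rw [LinearIndependent.pair_iff]
    intro s t h
    have him := congrArg Complex.im h
    have hre := congrArg Complex.re h
    have ht : t = 0 := by simpa [τ.im_ne_zero] using him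
    exact ⟨by simpa [ht] using hre, ht⟩
  have heq : (periodLattice τ : Set ℂ) = ((PeriodPair.mk 1 τ hind).lattice : Set ℂ) := by
    rw [PeriodPair.lattice, ← Submodule.coe_toAddSubgroup, Submodule.span_int_eq_addSubgroupClosure]
    rfl
  rw [heq]
  exact ⟨inferInstanceAs (DiscreteTopology (PeriodPair.mk 1 τ hind).lattice)⟩

/-- The elliptic curve `ℂ / (ℤ + ℤτ)`, with its group structure and its quotient topology. -/
abbrev EllipticCurveOfPeriod (τ : ℍ) : Type :=
  ℂ ⧸ periodLattice τ

/-- The charts of `ℂ / (ℤ + ℤτ)` are the local inverses of the projection of `ℂ`. -/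
instance (τ : ℍ) : ChartedSpace ℂ (EllipticCurveOfPeriod τ) :=
  ((periodLattice τ).isAddQuotientCoveringMap_of_comm
    (isDiscrete_periodLattice τ)).isCoveringMap.isLocalHomeomorph.chartedSpace
    QuotientAddGroup.mk_surjective

theorem mk_symm_chart (τ : ℍ) (e : OpenPartialHomeomorph (EllipticCurveOfPeriod τ) ℂ)
    (he : e ∈ atlas ℂ (EllipticCurveOfPeriod τ)) (x : ℂ) :
    e.symm x = (x : EllipticCurveOfPeriod τ) := by
  obtain ⟨q, rfl⟩ := he
  simp [chartAt_self_eq]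

/-- The elliptic curve is a complex manifold. -/
instance (τ : ℍ) : IsManifold 𝓘(ℂ, ℂ) ω (EllipticCurveOfPeriod τ) := by
  refine isManifold_of_contDiffOn _ _ _ fun e e' he he' => ?_
  simp only [modelWithCornersSelf_coe, modelWithCornersSelf_coe_symm, Function.comp_id,
    Function.id_comp, Set.preimage_id, Set.range_id, Set.inter_univ]
  set g := e.symm ≫ₕ e' with hg
  have hmem : ∀ y ∈ g.source, g y - y ∈ periodLattice τ := by
    intro y hy
    have hy' : e.symm y ∈ e'.source := by
      rw [hg, OpenPartialHomeomorph.trans_source] at hy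
      exact hy.2
    have h1 : (y : EllipticCurveOfPeriod τ) = (g y : ℂ) := by
      rw [← mk_symm_chart τ e' he' (g y), ← mk_symm_chart τ e he y]
      simp only [hg, OpenPartialHomeomorph.coe_trans, Function.comp_apply]
      rw [e'.left_inv hy']
    rw [QuotientAddGroup.eq] at h1
    rwa [sub_eq_neg_add]
  intro x hx
  obtain ⟨V, hV, hVd⟩ : ∃ V ∈ nhds (0 : ℂ), ∀ l ∈ periodLattice τ, l ∈ V → l = 0 := by
    have := (isDiscrete_periodLattice τ).1
    have h0 : ({0} : Set (periodLattice τ)) ∈ nhds (0 : periodLattice τ) := by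
      rw [nhds_discrete]; rfl
    rw [nhds_subtype_eq_comap, Filter.mem_comap] at h0
    obtain ⟨V, hV, h⟩ := h0
    exact ⟨V, hV, fun l hl hlV => congrArg Subtype.val (@h ⟨l, hl⟩ hlV)⟩
  have hc : ContinuousAt (fun y => (g y - y) - (g x - x)) x :=
    ((g.continuousAt hx).sub continuousAt_id).sub continuousAt_const
  have hev : ∀ᶠ y in nhds x, g y = y + (g x - x) := by
    filter_upwards [hc.preimage_mem_nhds (by simpa using hV),
      g.open_source.mem_nhds hx] with y hy hys
    have := hVd _ (sub_mem (hmem y hys) (hmem x hx)) hy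
    linear_combination this
  exact ((contDiffAt_id.add contDiffAt_const).congr_of_eventuallyEq hev).contDiffWithinAt

/-! ### Holomorphic principal bundles -/

/-- `p : P → B` is a holomorphic principal bundle for the given action of the (additively written)
complex Lie group `T` on `P`: the projection and the action are holomorphic, the action preserves
the fibres, and `p` has equivariant biholomorphic local trivializations around each point. -/
structure IsHolomorphicPrincipalBundle (T : Type*) {P B : Type*} (a b : ℕ) [AddGroup T]
    [TopologicalSpace T] [ChartedSpace ℂ T] [TopologicalSpace P] [ChartedSpace (Fin a → ℂ) P]
    [TopologicalSpace B] [ChartedSpace (Fin b → ℂ) B] [AddAction T P] (p : P → B) : Prop where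
  contMDiff_proj : ContMDiff 𝓘(ℂ, Fin a → ℂ) 𝓘(ℂ, Fin b → ℂ) ω p
  contMDiff_vadd : ContMDiff (𝓘(ℂ, ℂ).prod 𝓘(ℂ, Fin a → ℂ)) 𝓘(ℂ, Fin a → ℂ) ω
    (fun x : T × P => x.1 +ᵥ x.2)
  proj_vadd : ∀ (t : T) (x : P), p (t +ᵥ x) = p x
  exists_trivialization : ∀ y : B, ∃ e : Bundle.Trivialization T p, y ∈ e.baseSet ∧
    ContMDiffOn 𝓘(ℂ, Fin a → ℂ) (𝓘(ℂ, Fin b → ℂ).prod 𝓘(ℂ, ℂ)) ω e e.source ∧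
    ContMDiffOn (𝓘(ℂ, Fin b → ℂ).prod 𝓘(ℂ, ℂ)) 𝓘(ℂ, Fin a → ℂ) ω
      e.toOpenPartialHomeomorph.symm e.target ∧
    ∀ (t : T) (x : P), x ∈ e.source → e (t +ᵥ x) = ((e x).1, t + (e x).2)

end

/-!
A point of the LVMB manifold is an orbit in `U` of the group `ℂ × ℂᵐ`, in which `(s, u)` multiplies
the `j`-th coordinate by `exp(2πi(s + ⟨Λⱼ, u⟩))`. The Gale duality of `Λᴿ` and the independence of
the periods say together that the imaginary parts of these exponents identify `(ℂ × ℂᵐ) / (ℝ × 0)`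
with the space of linear relations among the vectors of the configuration (`IsAdmissible`,
`IsGaleDual.isAdmissible`). As the action changes `-log |zⱼ| / 2π` by these imaginary parts, all
topological questions become questions about the fan:

* the action is free up to `ℤ × 0` since a relation supported on a simplex is trivial;
* the quotient is Hausdorff since disjoint simplices have cones which meet only in the origin, which
  makes the action proper (`IsAdmissible.exists_pos_mul_norm_le`);
* the quotient is compact since, the fan being complete, each orbit meets a compact set on which the
  coordinates are bounded by `1` and those outside some maximal simplex have modulus `1`
  (`exists_simplex_of_star`, `IsAdmissible.exists_act_norm_le_one`).

The charts come from explicit slices (`IsAdmissible.exists_slice`): in the logarithms of the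
coordinates outside a maximal simplex `σ` the group acts by translations, and a linear complement of
these translations, together with the coordinates in `σ`, parametrizes the orbits.

For the enlarged configuration the rows `(1, l)` and `(τ, l)` are attached to the two new ghost
vectors, where `l` is arbitrary, and `(0, Λⱼ)` to the old ones. The new matrix `Λ'` is again
admissible, and every admissible matrix is `Λ'ᴿ Π'ᵀ` for `Π' = [iI | I]` and
`Λ'ᴿ = [Im Λ' | Re Λ']` (`IsAdmissible.isGaleDual`, `complexPoints_fromCols`). The enlarged open set
is `ℂˣ × ℂˣ × U`, the bundle projection is `[(a, b, z)] ↦ [z]`, and `t ∈ ℂ / (ℤ + ℤτ)` acts by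
`[(a, b, z)] ↦ [(a, exp(2πit) b, z)]`. If `χ` is a nonvanishing holomorphic function on a saturated
open subset of `U`, and `χ` is multiplied by `exp(2πi(s + ⟨l, u⟩))` under the action of `(s, u)`,
then `(log (b / χ(z)) - τ log (a / χ(z))) / 2πi` is a fibre coordinate and gives a trivialization
(`exists_trivialization`). Such functions exist near each point by means of the slices
(`Slice.exists_equivariant`). If the vector `j` is a ghost, the coordinate `zⱼ` vanishes nowhere on
`U`, so that for `l = Λⱼ` the function `χ(z) = zⱼ` trivializes the whole bundle.
-/

noncomputable section

open Filter Topology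

/-! ### The exponential `x ↦ exp(2πix)` -/

/-- The exponential `x ↦ exp(2πix)`, with kernel `ℤ`. -/
def expTwoPiI (x : ℂ) : ℂ := Complex.exp (2 * Real.pi * Complex.I * x)

theorem expTwoPiI_add (x y : ℂ) : expTwoPiI (x + y) = expTwoPiI x * expTwoPiI y := by
  simp [expTwoPiI, mul_add, Complex.exp_add]

theorem expTwoPiI_neg (x : ℂ) : expTwoPiI (-x) = (expTwoPiI x)⁻¹ := by
  simp [expTwoPiI, Complex.exp_neg]

@[simp]
theorem expTwoPiI_zero : expTwoPiI 0 = 1 := by simp [expTwoPiI]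

theorem expTwoPiI_ne_zero (x : ℂ) : expTwoPiI x ≠ 0 := Complex.exp_ne_zero _

theorem expTwoPiI_eq_one_iff {x : ℂ} : expTwoPiI x = 1 ↔ ∃ k : ℤ, x = k := by
  rw [expTwoPiI, Complex.exp_eq_one_iff]
  refine exists_congr fun k => ?_
  rw [mul_comm (k : ℂ), mul_right_inj' Complex.two_pi_I_ne_zero]

theorem expTwoPiI_eq_iff {x y : ℂ} : expTwoPiI x = expTwoPiI y ↔ ∃ k : ℤ, x = y + k := by
  rw [← div_eq_one_iff_eq (expTwoPiI_ne_zero y), div_eq_mul_inv, ← expTwoPiI_neg,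
    ← expTwoPiI_add, expTwoPiI_eq_one_iff]
  refine exists_congr fun k => ?_
  constructor <;> intro h <;> linear_combination h

@[simp]
theorem expTwoPiI_intCast (k : ℤ) : expTwoPiI k = 1 := expTwoPiI_eq_one_iff.2 ⟨k, rfl⟩

theorem norm_expTwoPiI (x : ℂ) : ‖expTwoPiI x‖ = Real.exp (-(2 * Real.pi * x.im)) := by
  simp [expTwoPiI, Complex.norm_exp]

theorem contDiff_expTwoPiI : ContDiff ℂ ω expTwoPiI :=
  Complex.contDiff_exp.comp (contDiff_const.mul contDiff_id)

theorem continuous_expTwoPiI : Continuous expTwoPiI := contDiff_expTwoPiI.continuous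

/-- The principal branch of the inverse of `expTwoPiI`. -/
def logTwoPiI (x : ℂ) : ℂ := Complex.log x / (2 * Real.pi * Complex.I)

theorem expTwoPiI_logTwoPiI {x : ℂ} (hx : x ≠ 0) : expTwoPiI (logTwoPiI x) = x := by
  rw [expTwoPiI, logTwoPiI, mul_div_cancel₀ _ Complex.two_pi_I_ne_zero, Complex.exp_log hx]

theorem contDiffAt_logTwoPiI {x : ℂ} (hx : x ∈ Complex.slitPlane) :
    ContDiffAt ℂ ω logTwoPiI x :=
  (Complex.contDiffAt_log hx).div_const _

@[simp]
theorem logTwoPiI_one : logTwoPiI 1 = 0 := by simp [logTwoPiI]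

theorem logTwoPiI_expTwoPiI {x : ℂ} (h₁ : -(1 / 2) < x.re) (h₂ : x.re < 1 / 2) :
    logTwoPiI (expTwoPiI x) = x := by
  have hpi := Real.pi_pos
  have h := Complex.log_exp (x := 2 * Real.pi * Complex.I * x)
    (by simp; nlinarith) (by simp; nlinarith)
  rw [logTwoPiI, expTwoPiI, h, mul_div_cancel_left₀ _ Complex.two_pi_I_ne_zero]

theorem expTwoPiI_mem_slitPlane {x : ℂ} (h₁ : -(1 / 2) < x.re) (h₂ : x.re < 1 / 2) :
    expTwoPiI x ∈ Complex.slitPlane := by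
  have hpi := Real.pi_pos
  rw [expTwoPiI, Complex.mem_slitPlane_iff_arg, Complex.arg_exp]
  refine ⟨fun h => ?_, Complex.exp_ne_zero _⟩
  have h3 : (2 * Real.pi * Complex.I * x).im = 2 * Real.pi * x.re := by simp
  rw [h3, (toIocMod_eq_self Real.two_pi_pos).2 ⟨by nlinarith, by nlinarith⟩] at h
  nlinarith

namespace TriangulatedConfiguration

variable {E : Type*} [AddCommGroup E] [Module ℝ E] {n m : ℕ}

/-! ### The action of `ℂ × ℂᵐ` -/

/-- The linear form `(s, u) ↦ s + ⟨l, u⟩` on `ℂ × ℂᵐ`. -/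
def weight (l : Fin m → ℂ) : (ℂ × (Fin m → ℂ)) →ₗ[ℂ] ℂ where
  toFun g := g.1 + l ⬝ᵥ g.2
  map_add' g h := by
    simp [dotProduct_add]
    ring
  map_smul' c g := by
    simp [dotProduct_smul]
    ring

theorem weight_apply (l : Fin m → ℂ) (g : ℂ × (Fin m → ℂ)) : weight l g = g.1 + l ⬝ᵥ g.2 := rfl

theorem contDiff_weight (l : Fin m → ℂ) : ContDiff ℂ ω (weight l) :=
  (LinearMap.toContinuousLinearMap (weight l)).contDiff

/-- The exponents `s + ⟨Λⱼ, u⟩` of the action of `(s, u) ∈ ℂ × ℂᵐ`, where `s` acts through the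
scalar `exp(2πis)`. -/
def exponent (Λ : Matrix (Fin n) (Fin m) ℂ) : (ℂ × (Fin m → ℂ)) →ₗ[ℂ] (Fin n → ℂ) :=
  LinearMap.pi fun j => weight (Λ j)

theorem exponent_apply (Λ : Matrix (Fin n) (Fin m) ℂ) (g : ℂ × (Fin m → ℂ)) (j : Fin n) :
    exponent Λ g j = g.1 + Λ j ⬝ᵥ g.2 := rfl

/-- The diagonal action of `ℂ × ℂᵐ` on `ℂⁿ` whose orbits in `U` are the points of the
LVMB manifold. -/
def act (Λ : Matrix (Fin n) (Fin m) ℂ) (g : ℂ × (Fin m → ℂ)) (z : Fin n → ℂ) : Fin n → ℂ :=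
  fun j => expTwoPiI (exponent Λ g j) * z j

theorem act_apply (Λ : Matrix (Fin n) (Fin m) ℂ) (g : ℂ × (Fin m → ℂ)) (z : Fin n → ℂ)
    (j : Fin n) : act Λ g z j = expTwoPiI (exponent Λ g j) * z j := rfl

theorem act_add (Λ : Matrix (Fin n) (Fin m) ℂ) (g h : ℂ × (Fin m → ℂ)) (z : Fin n → ℂ) :
    act Λ (g + h) z = act Λ g (act Λ h z) := by
  ext j
  simp [act_apply, expTwoPiI_add, mul_assoc]

@[simp]
theorem act_zero (Λ : Matrix (Fin n) (Fin m) ℂ) (z : Fin n → ℂ) : act Λ 0 z = z := by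
  ext j
  simp [act_apply]

@[simp]
theorem act_neg_act (Λ : Matrix (Fin n) (Fin m) ℂ) (g : ℂ × (Fin m → ℂ)) (z : Fin n → ℂ) :
    act Λ (-g) (act Λ g z) = z := by
  rw [← act_add, neg_add_cancel, act_zero]

@[simp]
theorem act_act_neg (Λ : Matrix (Fin n) (Fin m) ℂ) (g : ℂ × (Fin m → ℂ)) (z : Fin n → ℂ) :
    act Λ g (act Λ (-g) z) = z := by
  rw [← act_add, add_neg_cancel, act_zero]

@[simp]
theorem act_intCast (Λ : Matrix (Fin n) (Fin m) ℂ) (k : ℤ) (z : Fin n → ℂ) :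
    act Λ ((k : ℂ), 0) z = z := by
  ext j
  simp [act_apply, exponent_apply]

theorem act_apply_eq_zero_iff (Λ : Matrix (Fin n) (Fin m) ℂ) (g : ℂ × (Fin m → ℂ))
    (z : Fin n → ℂ) (j : Fin n) : act Λ g z j = 0 ↔ z j = 0 := by
  simp [act_apply, expTwoPiI_ne_zero]

theorem contDiff_exponent (Λ : Matrix (Fin n) (Fin m) ℂ) : ContDiff ℂ ω (exponent Λ) :=
  (LinearMap.toContinuousLinearMap (exponent Λ)).contDiff

theorem continuous_exponent (Λ : Matrix (Fin n) (Fin m) ℂ) : Continuous (exponent Λ) :=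
  (contDiff_exponent Λ).continuous

theorem contDiff_act (Λ : Matrix (Fin n) (Fin m) ℂ) (g : ℂ × (Fin m → ℂ)) :
    ContDiff ℂ ω (act Λ g) :=
  contDiff_pi.2 fun j => contDiff_const.mul (contDiff_apply ℂ ℂ j)

theorem continuous_uncurry_act (Λ : Matrix (Fin n) (Fin m) ℂ) :
    Continuous fun x : (ℂ × (Fin m → ℂ)) × (Fin n → ℂ) => act Λ x.1 x.2 := by
  refine continuous_pi fun j => ?_
  have h : Continuous fun x : (ℂ × (Fin m → ℂ)) × (Fin n → ℂ) => exponent Λ x.1 j :=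
    (continuous_apply j).comp ((continuous_exponent Λ).comp continuous_fst)
  have h' : Continuous fun x : (ℂ × (Fin m → ℂ)) × (Fin n → ℂ) => x.2 j :=
    (continuous_apply j).comp continuous_snd
  exact (continuous_expTwoPiI.comp h).mul h'

theorem mem_U_iff {C : TriangulatedConfiguration E n} {z : Fin n → ℂ} :
    z ∈ C.U ↔ ∃ τ ∈ C.simplices, τ.card = Module.finrank ℝ E ∧ ∀ j ∉ τ, z j ≠ 0 := by
  rw [← SetLike.mem_coe, U, TopologicalSpace.Opens.coe_mk]
  simp [and_assoc]

theorem act_mem_U {C : TriangulatedConfiguration E n} (Λ : Matrix (Fin n) (Fin m) ℂ)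
    (g : ℂ × (Fin m → ℂ)) {z : Fin n → ℂ} (hz : z ∈ C.U) : act Λ g z ∈ C.U := by
  obtain ⟨τ, hτ, hc, h⟩ := mem_U_iff.1 hz
  exact mem_U_iff.2 ⟨τ, hτ, hc, fun j hj => by
    simpa [act_apply_eq_zero_iff] using h j hj⟩

theorem toLVMB_eq_iff {C : TriangulatedConfiguration E n} {Λ : Matrix (Fin n) (Fin m) ℂ}
    {z w : C.U} : C.toLVMB Λ z = C.toLVMB Λ w ↔ ∃ g, w.1 = act Λ g z.1 := by
  refine (Quotient.eq (r := C.orbitSetoid Λ)).trans ?_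
  constructor
  · rintro ⟨c, u, hc, h⟩
    refine ⟨(logTwoPiI c, u), funext fun j => ?_⟩
    rw [h j, act_apply, exponent_apply, expTwoPiI_add, expTwoPiI_logTwoPiI hc]
    rfl
  · rintro ⟨g, h⟩
    refine ⟨expTwoPiI g.1, g.2, expTwoPiI_ne_zero _, fun j => ?_⟩
    rw [h, act_apply, exponent_apply, expTwoPiI_add]
    rfl

/-- The action of an element of `ℂ × ℂᵐ` on `U`. -/
def actU (C : TriangulatedConfiguration E n) (Λ : Matrix (Fin n) (Fin m) ℂ)
    (g : ℂ × (Fin m → ℂ)) (z : C.U) : C.U :=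
  ⟨act Λ g z.1, act_mem_U Λ g z.2⟩

@[simp]
theorem toLVMB_actU (C : TriangulatedConfiguration E n) (Λ : Matrix (Fin n) (Fin m) ℂ)
    (g : ℂ × (Fin m → ℂ)) (z : C.U) : C.toLVMB Λ (C.actU Λ g z) = C.toLVMB Λ z :=
  (toLVMB_eq_iff.2 ⟨g, rfl⟩).symm

theorem continuous_actU (C : TriangulatedConfiguration E n) (Λ : Matrix (Fin n) (Fin m) ℂ)
    (g : ℂ × (Fin m → ℂ)) : Continuous (C.actU Λ g) :=
  ((contDiff_act Λ g).continuous.comp continuous_subtype_val).subtype_mk _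

theorem surjective_toLVMB (C : TriangulatedConfiguration E n) (Λ : Matrix (Fin n) (Fin m) ℂ) :
    Function.Surjective (C.toLVMB Λ) := Quotient.mk_surjective

theorem continuous_toLVMB (C : TriangulatedConfiguration E n) (Λ : Matrix (Fin n) (Fin m) ℂ) :
    Continuous (C.toLVMB Λ) := continuous_quotient_mk'

theorem isOpenMap_toLVMB (C : TriangulatedConfiguration E n) (Λ : Matrix (Fin n) (Fin m) ℂ) :
    IsOpenMap (C.toLVMB Λ) := by
  intro O hO
  have hq : IsQuotientMap (C.toLVMB Λ) := isQuotientMap_quot_mk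
  rw [← hq.isOpen_preimage]
  have : C.toLVMB Λ ⁻¹' (C.toLVMB Λ '' O) = ⋃ g, C.actU Λ g ⁻¹' O := by
    ext z
    simp only [Set.mem_preimage, Set.mem_image, Set.mem_iUnion]
    constructor
    · rintro ⟨w, hw, h⟩
      obtain ⟨g, hg⟩ := toLVMB_eq_iff.1 h.symm
      exact ⟨g, by rwa [show C.actU Λ g z = w from Subtype.ext hg.symm]⟩
    · rintro ⟨g, hg⟩
      exact ⟨_, hg, by simp⟩
  rw [this]
  exact isOpen_iUnion fun g => hO.preimage (C.continuous_actU Λ g)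

theorem isOpenQuotientMap_toLVMB (C : TriangulatedConfiguration E n)
    (Λ : Matrix (Fin n) (Fin m) ℂ) : IsOpenQuotientMap (C.toLVMB Λ) :=
  ⟨C.surjective_toLVMB Λ, C.continuous_toLVMB Λ, C.isOpenMap_toLVMB Λ⟩

/-! ### Admissible exponents -/

/-- The imaginary part of `exponent Λ` identifies `ℂ × ℂᵐ` modulo `ℝ × 0` with the space of linear
relations. This is the property of `Λ = Λᴿ Πᵀ` from which everything else follows. -/
structure IsAdmissible (C : TriangulatedConfiguration E n) (Λ : Matrix (Fin n) (Fin m) ℂ) :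
    Prop where
  im_mem : ∀ g, (fun j => (exponent Λ g j).im) ∈ C.relations
  exists_im_eq : ∀ r ∈ C.relations, ∃ g, ∀ j, (exponent Λ g j).im = r j
  eq_zero : ∀ g, (∀ j, (exponent Λ g j).im = 0) → g.1.im = 0 ∧ g.2 = 0

theorem mem_relations_iff {C : TriangulatedConfiguration E n} {r : Fin n → ℝ} :
    r ∈ C.relations ↔ ∑ j, r j • C.v j = 0 := Iff.rfl

/-- A linear relation supported on a simplex is trivial. -/
theorem eq_zero_of_mem_relations {C : TriangulatedConfiguration E n} {r : Fin n → ℝ}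
    (hr : r ∈ C.relations) {τ : Finset (Fin n)} (hτ : τ ∈ C.simplices) (h : ∀ j ∉ τ, r j = 0) :
    r = 0 := by
  rw [mem_relations_iff, ← Finset.sum_subset (Finset.subset_univ τ)
    (fun j _ hj => by rw [h j hj, zero_smul])] at hr
  have hl := linearIndepOn_finset_iff.1 (C.linearIndependent τ hτ) r hr
  ext j
  by_cases hj : j ∈ τ
  · exact hl j hj
  · exact h j hj

/-- An element of `ℂ × ℂᵐ` whose exponents outside a simplex are real acts by a scalar. -/
theorem IsAdmissible.eq_zero_of_simplex {C : TriangulatedConfiguration E n}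
    {Λ : Matrix (Fin n) (Fin m) ℂ} (h : C.IsAdmissible Λ) {τ : Finset (Fin n)}
    (hτ : τ ∈ C.simplices) {g : ℂ × (Fin m → ℂ)} (hg : ∀ j ∉ τ, (exponent Λ g j).im = 0) :
    g.1.im = 0 ∧ g.2 = 0 :=
  h.eq_zero g fun j => congrFun (eq_zero_of_mem_relations (h.im_mem g) hτ hg) j

/-- The action of `ℂ × ℂᵐ` modulo `ℤ × 0` on `U` is free. -/
theorem IsAdmissible.act_eq_self {C : TriangulatedConfiguration E n}
    {Λ : Matrix (Fin n) (Fin m) ℂ} (h : C.IsAdmissible Λ) (hn : Module.finrank ℝ E < n)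
    {g : ℂ × (Fin m → ℂ)} {z : Fin n → ℂ} (hz : z ∈ C.U) (hg : act Λ g z = z) :
    ∃ k : ℤ, g = (↑k, 0) := by
  obtain ⟨τ, hτ, hc, hτz⟩ := mem_U_iff.1 hz
  have key : ∀ j ∉ τ, ∃ k : ℤ, exponent Λ g j = k := fun j hj =>
    expTwoPiI_eq_one_iff.1 (mul_right_cancel₀ (hτz j hj) (by
      rw [one_mul]; exact congrFun hg j))
  obtain ⟨-, h2⟩ := h.eq_zero_of_simplex hτ (g := g) fun j hj => by
    obtain ⟨k, hk⟩ := key j hj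
    simp [hk]
  obtain ⟨j, hj⟩ : ∃ j, j ∉ τ := by
    by_contra! hall
    rw [Finset.eq_univ_iff_forall.2 hall] at hc
    simp at hc
    omega
  obtain ⟨k, hk⟩ := key j hj
  refine ⟨k, Prod.ext ?_ h2⟩
  rw [exponent_apply, h2] at hk
  simpa using hk

/-! ### Stars in a complete simplicial fan -/

theorem coneOver_univ_eq_univ {C : TriangulatedConfiguration E n} (hbal : C.IsBalanced) :
    coneOver C.v Finset.univ = Set.univ := by
  refine Set.eq_univ_of_forall fun x => ?_
  have hx : x ∈ Submodule.span ℝ (Set.range C.v) := by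
    rw [C.span_eq_top]
    trivial
  obtain ⟨c, rfl⟩ := (Submodule.mem_span_range_iff_exists_fun ℝ).1 hx
  refine ⟨fun j => c j + ∑ i, |c i|, fun j => ?_, ?_⟩
  · have h1 : |c j| ≤ ∑ i, |c i| := Finset.single_le_sum (f := fun i => |c i|)
      (fun i _ => abs_nonneg _) (Finset.mem_univ j)
    have h2 := neg_abs_le (c j)
    linarith
  · have h0 : ∑ j, C.v j = 0 := hbal
    simp only [add_smul, Finset.sum_add_distrib, ← Finset.smul_sum, h0, smul_zero, add_zero]

theorem exists_mem_coneOver {C : TriangulatedConfiguration E n} (hbal : C.IsBalanced) (x : E) :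
    ∃ τ ∈ C.simplices, x ∈ coneOver C.v τ := by
  have hx := C.cone_cover (coneOver_univ_eq_univ hbal ▸ Set.mem_univ x)
  simpa using hx

/-- The vectors of a simplex whose span is everything give linear coordinates on `E`. -/
theorem exists_coordinates (C : TriangulatedConfiguration E n) {τ : Finset (Fin n)}
    (hτ : τ ∈ C.simplices) (hspan : Submodule.span ℝ (C.v '' τ) = ⊤) :
    ∃ f : E →ₗ[ℝ] (Fin n → ℝ), (∀ x, ∑ j ∈ τ, f x j • C.v j = x) ∧
      ∀ c : Fin n → ℝ, ∀ j ∈ τ, f (∑ i ∈ τ, c i • C.v i) j = c j := by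
  set T : (Fin n → ℝ) →ₗ[ℝ] E := ∑ j ∈ τ, (LinearMap.proj j).smulRight (C.v j) with hT
  have hTa : ∀ c, T c = ∑ j ∈ τ, c j • C.v j := fun c => by simp [hT, LinearMap.sum_apply]
  have hsurj : T.range = ⊤ := by
    rw [eq_top_iff, ← hspan, Submodule.span_le]
    rintro _ ⟨j, hj, rfl⟩
    refine ⟨Pi.single j 1, ?_⟩
    rw [hTa, Finset.sum_eq_single j (fun i _ hi => by simp [hi])
      (fun h => absurd (Finset.mem_coe.1 hj) h)]
    simp
  obtain ⟨f, hf⟩ := T.exists_rightInverse_of_surjective hsurj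
  have hf' : ∀ x, T (f x) = x := fun x => LinearMap.congr_fun hf x
  refine ⟨f, fun x => by rw [← hTa, hf'], fun c j hj => ?_⟩
  rw [← hTa]
  have hl := linearIndepOn_finset_iff.1 (C.linearIndependent τ hτ)
    (fun i => f (T c) i - c i) (by
      simp only [sub_smul, Finset.sum_sub_distrib, ← hTa, hf', sub_self]) j hj
  exact sub_eq_zero.1 hl

theorem card_eq_finrank {C : TriangulatedConfiguration E n} {τ : Finset (Fin n)}
    (hτ : τ ∈ C.simplices) (hspan : Submodule.span ℝ (C.v '' τ) = ⊤) :
    τ.card = Module.finrank ℝ E := by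
  rw [Set.image_eq_range] at hspan
  have := finrank_span_eq_card (C.linearIndependent τ hτ)
  rw [Fintype.card_coe] at this
  rw [← this, ← finrank_top ℝ E, ← hspan]
  rfl

theorem coneOver_subset_span (v : Fin n → E) (τ : Finset (Fin n)) :
    coneOver v τ ⊆ Submodule.span ℝ (v '' τ) := by
  rintro _ ⟨c, -, rfl⟩
  exact sum_mem fun j hj => Submodule.smul_mem _ _ (Submodule.subset_span ⟨j, hj, rfl⟩)

/-- In a complete simplicial fan, for each simplex `I` and each `x`, the point `x` moved far in the
direction of the barycentre of `I` lies in the cone of a simplex of maximal dimension containing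
`I`. The simplex is found as one that contains `w + t x + t² y` for arbitrarily small `t > 0`, where
`w` is the barycentre of `I` and `y` is generic. -/
theorem exists_simplex_of_star {C : TriangulatedConfiguration E n} (hbal : C.IsBalanced)
    {I : Finset (Fin n)} (hI : I ∈ C.simplices) (x : E) :
    ∃ τ ∈ C.simplices, I ⊆ τ ∧ τ.card = Module.finrank ℝ E ∧ ∃ (N : ℝ) (c : Fin n → ℝ),
      (∀ j ∈ τ, 0 ≤ c j) ∧ x + N • ∑ i ∈ I, C.v i = ∑ j ∈ τ, c j • C.v j := by
  classical
  set w := ∑ i ∈ I, C.v i with hw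
  -- a direction outside all proper subspaces spanned by simplices
  obtain ⟨y, hy⟩ : ∃ y : E, ∀ τ : Finset (Fin n), Submodule.span ℝ (C.v '' τ) ≠ ⊤ →
      y ∉ Submodule.span ℝ (C.v '' τ) := by
    set s : Finset (Subspace ℝ E) := (Finset.univ.image fun τ : Finset (Fin n) =>
      Submodule.span ℝ (C.v '' τ)).erase ⊤ with hs
    have h := Subspace.biUnion_ne_univ_of_top_notMem (s := s) (by simp [hs])
    rw [Set.ne_univ_iff_exists_notMem] at h
    obtain ⟨y, hy⟩ := h
    refine ⟨y, fun τ hτ hyτ => hy ?_⟩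
    simp only [Set.mem_iUnion]
    exact ⟨_, Finset.mem_erase.2 ⟨hτ, Finset.mem_image_of_mem _ (Finset.mem_univ τ)⟩, hyτ⟩
  set p : ℝ → E := fun t => w + t • x + t ^ 2 • y with hp
  obtain ⟨τ, hτ, hfreq⟩ : ∃ τ ∈ C.simplices, ∃ᶠ t in 𝓝[>] (0 : ℝ), p t ∈ coneOver C.v τ := by
    by_contra! hcon
    have hall : ∀ᶠ t in 𝓝[>] (0 : ℝ), ∀ τ : Finset (Fin n), τ ∈ C.simplices →
        p t ∉ coneOver C.v τ := by
      refine eventually_all.2 fun τ => ?_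
      by_cases hτ : τ ∈ C.simplices
      · filter_upwards [hcon τ hτ] with t ht _ using ht
      · exact Eventually.of_forall fun t h => absurd h hτ
    obtain ⟨t, ht⟩ := hall.exists
    obtain ⟨τ, hτ, h⟩ := exists_mem_coneOver hbal (p t)
    exact ht τ hτ h
  -- three points of the parabola in a subspace force `y` into it
  have hspan : Submodule.span ℝ (C.v '' τ) = ⊤ := by
    by_contra hne
    refine hy τ hne ?_
    obtain ⟨t₁, h₁, p₁⟩ := (hfreq.and_eventually self_mem_nhdsWithin).exists
    obtain ⟨t₂, h₂, p₂⟩ := (hfreq.and_eventually (Ioo_mem_nhdsGT p₁)).exists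
    obtain ⟨t₃, h₃, p₃⟩ := (hfreq.and_eventually (Ioo_mem_nhdsGT p₂.1)).exists
    have d₁ : t₁ - t₂ ≠ 0 := (by linarith [p₂.2] : 0 < t₁ - t₂).ne'
    have d₂ : t₁ - t₃ ≠ 0 := (by linarith [p₂.2, p₃.2] : 0 < t₁ - t₃).ne'
    have d₃ : t₂ - t₃ ≠ 0 := (by linarith [p₃.2] : 0 < t₂ - t₃).ne'
    have e : y = (1 / ((t₁ - t₂) * (t₁ - t₃))) • p t₁ - (1 / ((t₁ - t₂) * (t₂ - t₃))) • p t₂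
        + (1 / ((t₁ - t₃) * (t₂ - t₃))) • p t₃ := by
      simp only [hp]
      match_scalars <;> field_simp <;> ring
    rw [e]
    have hm := fun t (h : p t ∈ coneOver C.v τ) => coneOver_subset_span C.v τ h
    exact add_mem (sub_mem (Submodule.smul_mem _ _ (hm _ h₁)) (Submodule.smul_mem _ _ (hm _ h₂)))
      (Submodule.smul_mem _ _ (hm _ h₃))
  obtain ⟨f, hf, hf'⟩ := C.exists_coordinates hτ hspan
  have hfp : ∀ t j, f (p t) j = f w j + t * f x j + t ^ 2 * f y j := fun t j => by
    simp [hp]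
  have hfreq' : ∀ j ∈ τ, ∃ᶠ t in 𝓝[>] (0 : ℝ), 0 ≤ f w j + t * f x j + t ^ 2 * f y j := by
    intro j hj
    refine hfreq.mono fun t ht => ?_
    obtain ⟨c, hc, hpc⟩ := ht
    rw [← hfp, hpc, hf' c j hj]
    exact hc j
  have hwpos : ∀ j ∈ τ, 0 ≤ f w j := by
    intro j hj
    refine ge_of_tendsto_of_frequently (f := fun t => f w j + t * f x j + t ^ 2 * f y j)
      (tendsto_nhdsWithin_of_tendsto_nhds ?_) (hfreq' j hj)
    have : Continuous fun t : ℝ => f w j + t * f x j + t ^ 2 * f y j := by fun_prop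
    simpa using this.tendsto 0
  have hIτ : I ⊆ τ := by
    have hmem : w ∈ coneOver C.v τ ∩ coneOver C.v I := by
      refine ⟨⟨fun j => max (f w j) 0, fun j => le_max_right _ _, ?_⟩, fun _ => 1,
        fun _ => zero_le_one, by simp [hw]⟩
      refine (hf w).symm.trans (Finset.sum_congr rfl fun j hj => ?_)
      simp only [max_eq_left (hwpos j hj)]
    rw [C.cone_inter τ hτ I hI] at hmem
    obtain ⟨c, -, hc⟩ := hmem
    have hrel : (fun j => (if j ∈ I then 1 else 0) - (if j ∈ τ ∩ I then c j else 0)) ∈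
        C.relations := by
      rw [mem_relations_iff]
      simp only [sub_smul, Finset.sum_sub_distrib, ite_smul, one_smul, zero_smul]
      rw [← Finset.sum_filter, ← Finset.sum_filter, Finset.filter_mem_eq_inter,
        Finset.filter_mem_eq_inter, Finset.univ_inter, Finset.univ_inter, ← hc, sub_self]
    have h0 := eq_zero_of_mem_relations hrel hI fun j hj => by simp [hj]
    intro j hj
    by_contra hjτ
    have := congrFun h0 j
    simp [hj, hjτ] at this
  have hwI : ∀ j ∈ τ, f w j = if j ∈ I then 1 else 0 := by
    intro j hj
    have : w = ∑ i ∈ τ, (if i ∈ I then (1 : ℝ) else 0) • C.v i := by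
      simp only [ite_smul, one_smul, zero_smul]
      rw [← Finset.sum_filter, Finset.filter_mem_eq_inter, Finset.inter_eq_right.2 hIτ]
    rw [this, hf' _ j hj]
  have hxpos : ∀ j ∈ τ, j ∉ I → 0 ≤ f x j := by
    intro j hj hjI
    refine ge_of_tendsto_of_frequently (f := fun t => f x j + t * f y j)
      (tendsto_nhdsWithin_of_tendsto_nhds (a := (0 : ℝ)) ?_)
      (((hfreq' j hj).and_eventually self_mem_nhdsWithin).mono ?_)
    · have : Continuous fun t : ℝ => f x j + t * f y j := by fun_prop
      simpa using this.tendsto 0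
    · rintro t ⟨ht, htpos⟩
      rw [hwI j hj, if_neg hjI] at ht
      have htpos : 0 < t := htpos
      refine nonneg_of_mul_nonneg_right (a := t) ?_ htpos
      linarith
  refine ⟨τ, hτ, hIτ, card_eq_finrank hτ hspan, ∑ j, |f x j|,
    f (x + (∑ j, |f x j|) • w), fun j hj => ?_, (hf _).symm⟩
  have hsum : 0 ≤ ∑ j, |f x j| := Finset.sum_nonneg fun _ _ => abs_nonneg _
  simp only [map_add, map_smul, Pi.add_apply, Pi.smul_apply, smul_eq_mul, hwI j hj]
  by_cases hjI : j ∈ I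
  · have h1 := Finset.single_le_sum (f := fun i => |f x i|) (fun i _ => abs_nonneg _)
      (Finset.mem_univ j)
    have h2 := neg_abs_le (f x j)
    simp only [hjI, if_true, mul_one] at h1 ⊢
    linarith
  · simpa [hjI] using hxpos j hj hjI

/-! ### Compactness -/

theorem zeros_mem_simplices {C : TriangulatedConfiguration E n} {z : Fin n → ℂ}
    (hz : z ∈ C.U) : (Finset.univ.filter fun j => z j = 0) ∈ C.simplices := by
  obtain ⟨τ, hτ, -, h⟩ := mem_U_iff.1 hz
  refine C.down_closed τ hτ _ fun j hj => ?_
  by_contra hjτ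
  exact h j hjτ (by simpa using hj)

/-- Each orbit in `U` contains a point of the polydisc with all coordinates outside some simplex of
maximal dimension on the unit circle. -/
theorem IsAdmissible.exists_act_norm_le_one {C : TriangulatedConfiguration E n}
    {Λ : Matrix (Fin n) (Fin m) ℂ} (h : C.IsAdmissible Λ) (hbal : C.IsBalanced)
    {z : Fin n → ℂ} (hz : z ∈ C.U) : ∃ g, ∃ τ ∈ C.simplices, τ.card = Module.finrank ℝ E ∧
      (∀ j, ‖act Λ g z j‖ ≤ 1) ∧ ∀ j ∉ τ, ‖act Λ g z j‖ = 1 := by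
  set I := Finset.univ.filter fun j => z j = 0 with hIdef
  have hI : I ∈ C.simplices := zeros_mem_simplices hz
  have hmem : ∀ j, j ∈ I ↔ z j = 0 := fun j => by simp [hIdef]
  -- `log 0 = 0`, so the coordinates in `I` do not contribute
  obtain ⟨τ, hτ, hIτ, hcard, N, c, hc, hsum⟩ := exists_simplex_of_star hbal hI
    (∑ j, (-Real.log ‖z j‖) • C.v j)
  have hrel : (fun j => -(2 * Real.pi)⁻¹ * (-Real.log ‖z j‖ + (if j ∈ I then N else 0)
      - (if j ∈ τ then c j else 0))) ∈ C.relations := by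
    refine C.relations.smul_mem (-(2 * Real.pi)⁻¹)
      (x := fun j => -Real.log ‖z j‖ + (if j ∈ I then N else 0) - (if j ∈ τ then c j else 0)) ?_
    rw [mem_relations_iff]
    simp only [sub_smul, add_smul, Finset.sum_sub_distrib, Finset.sum_add_distrib, ite_smul,
      zero_smul]
    rw [← Finset.sum_filter, ← Finset.sum_filter, Finset.filter_mem_eq_inter,
      Finset.filter_mem_eq_inter, Finset.univ_inter, Finset.univ_inter, ← Finset.smul_sum, hsum,
      sub_self]
  obtain ⟨g, hg⟩ := h.exists_im_eq _ hrel
  have hnorm : ∀ j, z j ≠ 0 → ‖act Λ g z j‖ = Real.exp (-(if j ∈ τ then c j else 0)) := by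
    intro j hj
    rw [act_apply, norm_mul, norm_expTwoPiI, hg, if_neg (fun h => hj ((hmem j).1 h))]
    conv_lhs => rw [← Real.exp_log (norm_pos_iff.2 hj), ← Real.exp_add, Real.log_exp]
    congr 1
    field_simp [Real.pi_ne_zero]
    ring
  refine ⟨g, τ, hτ, hcard, fun j => ?_, fun j hj => ?_⟩
  · by_cases hj : z j = 0
    · simp [act_apply, hj]
    · rw [hnorm j hj, Real.exp_le_one_iff]
      split_ifs with hjτ
      · linarith [hc j hjτ]
      · simp
  · have hzj : z j ≠ 0 := fun h0 => hj (hIτ ((hmem j).2 h0))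
    rw [hnorm j hzj, if_neg hj]
    simp

theorem IsAdmissible.compactSpace {C : TriangulatedConfiguration E n}
    {Λ : Matrix (Fin n) (Fin m) ℂ} (h : C.IsAdmissible Λ) (hbal : C.IsBalanced) :
    CompactSpace (C.LVMB Λ) := by
  set K : Finset (Fin n) → Set (Fin n → ℂ) := fun τ =>
    (Set.univ.pi fun _ => Metric.closedBall 0 1) ∩ ⋂ j ∈ τᶜ, {z | ‖z j‖ = 1} with hK
  have hKc : ∀ τ, IsCompact (K τ) := fun τ =>
    (isCompact_univ_pi fun _ => isCompact_closedBall _ _).inter_right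
      (isClosed_biInter fun j _ => isClosed_eq (continuous_apply j).norm continuous_const)
  have hKmem : ∀ τ z, z ∈ K τ ↔ (∀ j, ‖z j‖ ≤ 1) ∧ ∀ j ∉ τ, ‖z j‖ = 1 := fun τ z => by
    simp [hK, Set.mem_pi]
  set S : Set (Finset (Fin n)) := {τ | τ ∈ C.simplices ∧ τ.card = Module.finrank ℝ E} with hS
  have hKU : ∀ τ ∈ S, K τ ⊆ Set.range (Subtype.val : C.U → Fin n → ℂ) := by
    rintro τ ⟨hτ, hc⟩ z hz
    refine ⟨⟨z, mem_U_iff.2 ⟨τ, hτ, hc, fun j hj h0 => ?_⟩⟩, rfl⟩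
    have := ((hKmem τ z).1 hz).2 j hj
    simp [h0] at this
  have hcomp : IsCompact (⋃ τ ∈ S, C.toLVMB Λ '' (Subtype.val ⁻¹' K τ)) := by
    refine (Set.toFinite S).isCompact_biUnion fun τ hτ => ?_
    refine IsCompact.image ?_ (C.continuous_toLVMB Λ)
    refine Topology.IsInducing.subtypeVal.isCompact_iff.2 ?_
    convert hKc τ
    exact Set.image_preimage_eq_of_subset (hKU τ hτ)
  refine ⟨?_⟩
  convert hcomp
  refine (Set.eq_univ_of_forall fun q => ?_).symm
  obtain ⟨z, rfl⟩ := C.surjective_toLVMB Λ q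
  obtain ⟨g, τ, hτ, hc, h1, h2⟩ := h.exists_act_norm_le_one hbal z.2
  simp only [Set.mem_iUnion]
  exact ⟨τ, ⟨hτ, hc⟩, C.actU Λ g z, (hKmem τ _).2 ⟨h1, h2⟩, by simp⟩

/-! ### The Hausdorff property -/

/-- A continuous positively homogeneous function on a finite-dimensional space which is positive
away from the origin bounds the norm. -/
theorem _root_.exists_pos_mul_norm_le_of_homogeneous {F : Type*} [NormedAddCommGroup F]
    [NormedSpace ℝ F] [FiniteDimensional ℝ F] {φ : F → ℝ} (hc : Continuous φ)
    (hpos : ∀ x ≠ 0, 0 < φ x) (hhom : ∀ t : ℝ, 0 < t → ∀ x, φ (t • x) = t * φ x) :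
    ∃ c > 0, ∀ x, c * ‖x‖ ≤ φ x := by
  have h0 : φ 0 = 0 := by
    have := hhom 2 two_pos 0
    rw [smul_zero] at this
    linarith
  have := FiniteDimensional.proper ℝ F
  rcases (Metric.sphere (0 : F) 1).eq_empty_or_nonempty with he | hne
  · refine ⟨1, one_pos, fun x => ?_⟩
    by_cases hx : x = 0
    · simp [hx, h0]
    · have hx' : ‖x‖⁻¹ • x ∈ Metric.sphere (0 : F) 1 := by
        simp [norm_smul, hx]
      simp [he] at hx'
  · obtain ⟨x₀, hx₀, hmin⟩ := (isCompact_sphere (0 : F) 1).exists_isMinOn hne hc.continuousOn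
    refine ⟨φ x₀, hpos _ fun h => by simp [h] at hx₀, fun x => ?_⟩
    by_cases hx : x = 0
    · simp [hx, h0]
    · have hx' : ‖x‖⁻¹ • x ∈ Metric.sphere (0 : F) 1 := by
        simp [norm_smul, hx]
      have hle : φ x₀ ≤ φ (‖x‖⁻¹ • x) := hmin hx'
      have hn : 0 < ‖x‖ := norm_pos_iff.2 hx
      rw [hhom _ (inv_pos.2 hn), inv_mul_eq_div, le_div_iff₀ hn] at hle
      exact hle

/-- The cones of disjoint simplices meet only in the origin: a linear relation which is nonnegative
off a simplex and nonpositive off another one is trivial. -/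
theorem eq_zero_of_nonneg_of_nonpos {C : TriangulatedConfiguration E n} {r : Fin n → ℝ}
    (hr : r ∈ C.relations) {I J : Finset (Fin n)} (hI : I ∈ C.simplices) (hJ : J ∈ C.simplices)
    (h₁ : ∀ j ∉ I, 0 ≤ r j) (h₂ : ∀ j ∉ J, r j ≤ 0) : r = 0 := by
  classical
  set P := Finset.univ.filter fun j => 0 < r j with hPdef
  set Q := Finset.univ.filter fun j => r j < 0 with hQdef
  have hP : P ∈ C.simplices := C.down_closed J hJ _ fun j hj => by
    by_contra hjJ
    exact absurd (h₂ j hjJ) (by simpa [hPdef] using hj)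
  have hQ : Q ∈ C.simplices := C.down_closed I hI _ fun j hj => by
    by_contra hjI
    exact absurd (h₁ j hjI) (by simpa [hQdef] using hj)
  have hPsum : ∑ j, max (r j) 0 • C.v j = ∑ j ∈ P, max (r j) 0 • C.v j :=
    (Finset.sum_subset (Finset.subset_univ P) fun j _ hj => by
      rw [max_eq_right (by simpa [hPdef] using hj), zero_smul]).symm
  have hQsum : ∑ j, max (-r j) 0 • C.v j = ∑ j ∈ Q, max (-r j) 0 • C.v j :=
    (Finset.sum_subset (Finset.subset_univ Q) fun j _ hj => by
      rw [max_eq_right (by simpa [hQdef] using hj), zero_smul]).symm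
  have heq : ∑ j, max (r j) 0 • C.v j = ∑ j, max (-r j) 0 • C.v j := by
    rw [← sub_eq_zero, ← Finset.sum_sub_distrib, ← mem_relations_iff.1 hr]
    refine Finset.sum_congr rfl fun j _ => ?_
    rw [← sub_smul]
    congr 1
    rcases le_total 0 (r j) with h | h
    · rw [max_eq_left h, max_eq_right (by linarith), sub_zero]
    · rw [max_eq_right h, max_eq_left (by linarith)]
      ring
  have hzero : ∑ j, max (r j) 0 • C.v j = 0 := by
    have hmem : ∑ j, max (r j) 0 • C.v j ∈ coneOver C.v P ∩ coneOver C.v Q :=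
      ⟨⟨fun j => max (r j) 0, fun j => le_max_right _ _, hPsum⟩,
        ⟨fun j => max (-r j) 0, fun j => le_max_right _ _, heq.trans hQsum⟩⟩
    have hdisj : P ∩ Q = ∅ := by
      ext j
      simp only [hPdef, hQdef, Finset.mem_inter, Finset.mem_filter, Finset.mem_univ, true_and,
        Finset.notMem_empty, iff_false, not_and, not_lt]
      exact le_of_lt
    rw [C.cone_inter P hP Q hQ, hdisj] at hmem
    obtain ⟨c, -, hc⟩ := hmem
    simpa using hc
  have h3 := eq_zero_of_mem_relations (r := fun j => max (r j) 0) hzero hP fun j hj =>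
    max_eq_right (by simpa [hPdef] using hj)
  have h4 := eq_zero_of_mem_relations (r := fun j => max (-r j) 0) (heq.symm.trans hzero) hQ
    fun j hj => max_eq_right (by simpa [hQdef] using hj)
  ext j
  have h5 : max (r j) 0 = 0 := congrFun h3 j
  have h6 : max (-r j) 0 = 0 := congrFun h4 j
  have h7 := le_max_left (r j) 0
  have h8 := le_max_left (-r j) 0
  simp only [Pi.zero_apply]
  linarith

/-- The properness of the action: a group element is bounded in terms of the sizes of the
exponents that the zero sets `I`, `J` of two points of `U` allow to control. -/
theorem IsAdmissible.exists_pos_mul_norm_le {C : TriangulatedConfiguration E n}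
    {Λ : Matrix (Fin n) (Fin m) ℂ} (h : C.IsAdmissible Λ) {I J : Finset (Fin n)}
    (hI : I ∈ C.simplices) (hJ : J ∈ C.simplices) :
    ∃ c > 0, ∀ g : ℂ × (Fin m → ℂ), c * ‖g‖ ≤ |g.1.re| +
      ∑ j ∈ Iᶜ, max (-(exponent Λ g j).im) 0 + ∑ j ∈ Jᶜ, max (exponent Λ g j).im 0 := by
  have hcont : ∀ j, Continuous fun g : ℂ × (Fin m → ℂ) => (exponent Λ g j).im := fun j =>
    Complex.continuous_im.comp ((continuous_apply j).comp (continuous_exponent Λ))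
  refine exists_pos_mul_norm_le_of_homogeneous ?_ ?_ ?_
  · refine ((Complex.continuous_re.comp continuous_fst).abs.add ?_).add ?_
    · exact continuous_finsetSum _ fun j _ => (hcont j).neg.max continuous_const
    · exact continuous_finsetSum _ fun j _ => (hcont j).max continuous_const
  · intro g hg
    have n1 : 0 ≤ |g.1.re| := abs_nonneg _
    have n2 : 0 ≤ ∑ j ∈ Iᶜ, max (-(exponent Λ g j).im) 0 :=
      Finset.sum_nonneg fun _ _ => le_max_right _ _
    have n3 : 0 ≤ ∑ j ∈ Jᶜ, max (exponent Λ g j).im 0 :=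
      Finset.sum_nonneg fun _ _ => le_max_right _ _
    refine lt_of_le_of_ne (by positivity) fun h0 => hg ?_
    have z1 : |g.1.re| = 0 := by linarith
    have z2 : ∑ j ∈ Iᶜ, max (-(exponent Λ g j).im) 0 = 0 := by linarith
    have z3 : ∑ j ∈ Jᶜ, max (exponent Λ g j).im 0 = 0 := by linarith
    rw [Finset.sum_eq_zero_iff_of_nonneg fun _ _ => le_max_right _ _] at z2 z3
    have hr := eq_zero_of_nonneg_of_nonpos (h.im_mem g) hI hJ
      (fun j hj => by
        have := z2 j (Finset.mem_compl.2 hj)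
        have h7 := le_max_left (-(exponent Λ g j).im) 0
        linarith)
      (fun j hj => by
        have := z3 j (Finset.mem_compl.2 hj)
        have h7 := le_max_left (exponent Λ g j).im 0
        linarith)
    obtain ⟨e1, e2⟩ := h.eq_zero g fun j => congrFun hr j
    exact Prod.ext (Complex.ext (abs_eq_zero.1 z1) e1) e2
  · intro t ht g
    have hsm : ∀ j, (exponent Λ (t • g) j).im = t * (exponent Λ g j).im := fun j => by
      rw [show t • g = (t : ℂ) • g by ext <;> simp, map_smul]
      simp
    have hmax : ∀ x : ℝ, max (t * x) 0 = t * max x 0 := fun x => by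
      rw [mul_max_of_nonneg _ _ ht.le, mul_zero]
    simp only [hsm, ← mul_neg, hmax, ← Finset.mul_sum, Prod.smul_fst, Complex.real_smul,
      Complex.re_ofReal_mul, abs_mul, abs_of_pos ht]
    ring

theorem neg_im_le_div_of_eq_expTwoPiI_mul {e z w : ℂ} (hz : z ≠ 0) (h : w = expTwoPiI e * z) :
    max (-e.im) 0 ≤ ‖w‖ / ‖z‖ := by
  refine max_le ?_ (by positivity)
  rw [h, norm_mul, mul_div_cancel_right₀ _ (norm_ne_zero_iff.2 hz), norm_expTwoPiI]
  rcases le_total 0 (-e.im) with h0 | h0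
  · have h1 := Real.add_one_le_exp (-(2 * Real.pi * e.im))
    have h2 := Real.pi_gt_three
    nlinarith
  · exact h0.trans (Real.exp_pos _).le

theorem IsAdmissible.t2Space {C : TriangulatedConfiguration E n}
    {Λ : Matrix (Fin n) (Fin m) ℂ} (h : C.IsAdmissible Λ) : T2Space (C.LVMB Λ) := by
  rw [t2Space_iff_of_isOpenQuotientMap (C.isOpenQuotientMap_toLVMB Λ)]
  refine IsSeqClosed.isClosed ?_
  rintro q ⟨z, w⟩ hq hlim
  have hz : Tendsto (fun k => (q k).1.1) atTop (𝓝 z.1) :=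
    (continuous_subtype_val.tendsto _).comp ((continuous_fst.tendsto _).comp hlim)
  have hw : Tendsto (fun k => (q k).2.1) atTop (𝓝 w.1) :=
    (continuous_subtype_val.tendsto _).comp ((continuous_snd.tendsto _).comp hlim)
  have hg : ∀ k, ∃ g : ℂ × (Fin m → ℂ), (q k).2.1 = act Λ g (q k).1.1 ∧ |g.1.re| ≤ 1 := by
    intro k
    obtain ⟨g, hg⟩ := toLVMB_eq_iff.1 (hq k)
    -- integers in the first factor act trivially
    refine ⟨g + (((-⌊g.1.re⌋ : ℤ) : ℂ), 0), ?_, ?_⟩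
    · rw [act_add, act_intCast, hg]
    · have h1 := Int.floor_le g.1.re
      have h2 := Int.lt_floor_add_one g.1.re
      rw [abs_le]
      constructor <;> simp <;> linarith
  choose g hg hg1 using hg
  -- the group elements are bounded, and the limit of a subsequence relates the limit points
  obtain ⟨c, hc, hbound⟩ := h.exists_pos_mul_norm_le (zeros_mem_simplices z.2)
    (zeros_mem_simplices w.2)
  have hzj : ∀ j, Tendsto (fun k => (q k).1.1 j) atTop (𝓝 (z.1 j)) := fun j =>
    tendsto_pi_nhds.1 hz j
  have hwj : ∀ j, Tendsto (fun k => (q k).2.1 j) atTop (𝓝 (w.1 j)) := fun j =>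
    tendsto_pi_nhds.1 hw j
  -- the exponents off the zero sets are controlled by quotients of coordinates
  have hB : ∃ B, ∀ᶠ k in atTop, ‖g k‖ ≤ B := by
    set S := (∑ j ∈ (Finset.univ.filter fun j => z.1 j = 0)ᶜ, ‖w.1 j‖ / ‖z.1 j‖) +
      ∑ j ∈ (Finset.univ.filter fun j => w.1 j = 0)ᶜ, ‖z.1 j‖ / ‖w.1 j‖ with hS
    have hlimS : Tendsto (fun k =>
        (∑ j ∈ (Finset.univ.filter fun j => z.1 j = 0)ᶜ, ‖(q k).2.1 j‖ / ‖(q k).1.1 j‖) +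
        ∑ j ∈ (Finset.univ.filter fun j => w.1 j = 0)ᶜ, ‖(q k).1.1 j‖ / ‖(q k).2.1 j‖)
        atTop (𝓝 S) := by
      refine (tendsto_finsetSum _ fun j hj => ?_).add (tendsto_finsetSum _ fun j hj => ?_)
      · exact (hwj j).norm.div (hzj j).norm (by simpa using hj)
      · exact (hzj j).norm.div (hwj j).norm (by simpa using hj)
    have ev1 : ∀ᶠ k in atTop, ∀ j, z.1 j ≠ 0 → (q k).1.1 j ≠ 0 := eventually_all.2 fun j => by
      by_cases hj : z.1 j = 0
      · exact Eventually.of_forall fun k h => absurd hj h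
      · exact ((hzj j).eventually_ne hj).mono fun k hk _ => hk
    have ev2 : ∀ᶠ k in atTop, ∀ j, w.1 j ≠ 0 → (q k).2.1 j ≠ 0 := eventually_all.2 fun j => by
      by_cases hj : w.1 j = 0
      · exact Eventually.of_forall fun k h => absurd hj h
      · exact ((hwj j).eventually_ne hj).mono fun k hk _ => hk
    refine ⟨(1 + (S + 1)) / c, ?_⟩
    filter_upwards [ev1, ev2, hlimS.eventually_lt_const (lt_add_one S)] with k k1 k2 k3
    rw [le_div_iff₀' hc]
    refine (hbound (g k)).trans ?_
    rw [add_assoc]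
    refine add_le_add (hg1 k) (le_trans (add_le_add ?_ ?_) k3.le)
    · exact Finset.sum_le_sum fun j hj => neg_im_le_div_of_eq_expTwoPiI_mul
        (k1 j (by simpa using hj)) (congrFun (hg k) j)
    · refine Finset.sum_le_sum fun j hj => ?_
      have := neg_im_le_div_of_eq_expTwoPiI_mul (e := -exponent Λ (g k) j)
        (k2 j (by simpa using hj)) (w := (q k).1.1 j) (by
          rw [hg k, act_apply, expTwoPiI_neg, inv_mul_cancel_left₀ (expTwoPiI_ne_zero _)])
      simpa using this
  obtain ⟨B, hB⟩ := hB
  obtain ⟨a, -, φ, hφ, ha⟩ := tendsto_subseq_of_frequently_bounded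
    (Metric.isBounded_closedBall (x := (0 : ℂ × (Fin m → ℂ))) (r := B))
    (hB.mono fun k hk => by simpa using hk).frequently
  refine toLVMB_eq_iff.2 ⟨a, ?_⟩
  refine tendsto_nhds_unique (hw.comp hφ.tendsto_atTop) ?_
  have := ((continuous_uncurry_act Λ).tendsto (a, z.1)).comp
    (ha.prodMk_nhds (hz.comp hφ.tendsto_atTop))
  refine this.congr fun k => ?_
  simp [hg]

/-! ### Linear algebra of slices -/

/-- Outside a simplex `τ`, the exponents determine the group element; this chooses a linear
retraction `α` onto the group which depends only on the coordinates outside `τ`. -/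
theorem IsAdmissible.exists_gauge {C : TriangulatedConfiguration E n}
    {Λ : Matrix (Fin n) (Fin m) ℂ} (h : C.IsAdmissible Λ) {τ : Finset (Fin n)}
    (hτ : τ ∈ C.simplices) {j₁ : Fin n} (hj₁ : j₁ ∉ τ) :
    ∃ α : (Fin n → ℂ) →ₗ[ℂ] (ℂ × (Fin m → ℂ)),
      (∀ x y : Fin n → ℂ, (∀ j ∉ τ, x j = y j) → α x = α y) ∧ ∀ g, α (exponent Λ g) = g := by
  classical
  set P : (Fin n → ℂ) →ₗ[ℂ] (Fin n → ℂ) :=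
    LinearMap.pi fun j => if j ∈ τ then 0 else LinearMap.proj j with hP
  have hPa : ∀ x j, P x j = if j ∈ τ then 0 else x j := fun x j => by
    simp only [hP, LinearMap.pi_apply]
    split_ifs <;> rfl
  have hinj : (P ∘ₗ exponent Λ).ker = ⊥ := by
    rw [LinearMap.ker_eq_bot']
    intro g hg
    have hg' : ∀ j ∉ τ, exponent Λ g j = 0 := fun j hj => by
      have := congrFun hg j
      rwa [LinearMap.comp_apply, hPa, if_neg hj] at this
    obtain ⟨-, h2⟩ := h.eq_zero_of_simplex hτ (g := g) fun j hj => by rw [hg' j hj]; rfl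
    refine Prod.ext ?_ h2
    have := hg' j₁ hj₁
    rw [exponent_apply, h2] at this
    simpa using this
  obtain ⟨α, hα⟩ := LinearMap.exists_leftInverse_of_injective _ hinj
  refine ⟨α ∘ₗ P, fun x y hxy => ?_, fun g => LinearMap.congr_fun hα g⟩
  rw [LinearMap.comp_apply, LinearMap.comp_apply]
  congr 1
  ext j
  rw [hPa, hPa]
  split_ifs with hj
  · rfl
  · exact hxy j hj

/-- Linear coordinates on the kernel of a retraction onto the group. -/
theorem exists_slice_coordinates {k : ℕ} (hn : n = k + (m + 1)) {Λ : Matrix (Fin n) (Fin m) ℂ}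
    {α : (Fin n → ℂ) →ₗ[ℂ] (ℂ × (Fin m → ℂ))} (hα : ∀ g, α (exponent Λ g) = g) :
    ∃ (i : (Fin k → ℂ) →ₗ[ℂ] (Fin n → ℂ)) (r : (Fin n → ℂ) →ₗ[ℂ] (Fin k → ℂ)),
      (∀ y, r (i y) = y) ∧ (∀ x, α x = 0 → i (r x) = x) ∧ ∀ y, α (i y) = 0 := by
  have hdim : Module.finrank ℂ α.ker = k := by
    have h1 := α.finrank_range_add_finrank_ker
    rw [LinearMap.range_eq_top.2 fun g => ⟨_, hα g⟩, finrank_top] at h1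
    simp at h1
    omega
  have e : (Fin k → ℂ) ≃ₗ[ℂ] α.ker := LinearEquiv.ofFinrankEq _ _ (by simp [hdim])
  obtain ⟨r, hr⟩ := LinearMap.exists_leftInverse_of_injective (α.ker.subtype ∘ₗ e.toLinearMap)
    (LinearMap.ker_eq_bot.2 (α.ker.injective_subtype.comp e.injective))
  have hr' : ∀ y, r (e y : Fin n → ℂ) = y := fun y => LinearMap.congr_fun hr y
  refine ⟨α.ker.subtype ∘ₗ e.toLinearMap, r, hr', fun x hx => ?_, fun y => (e y).2⟩
  have hy := e.apply_symm_apply ⟨x, hx⟩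
  have hx' : (e (e.symm ⟨x, hx⟩) : Fin n → ℂ) = x := congrArg Subtype.val hy
  change (e (r x) : Fin n → ℂ) = x
  conv_lhs => rw [← hx', hr', hx']

/-- Two points of the slice close to its centre in the same orbit agree outside `τ`, and are related
by an element acting trivially. The integral ambiguity `k` of the logarithms is subject to
`k - k_{j₁} (1, …, 1)` being small modulo the exponents of the group, hence zero. -/
theorem IsAdmissible.exists_radius {C : TriangulatedConfiguration E n}
    {Λ : Matrix (Fin n) (Fin m) ℂ} (h : C.IsAdmissible Λ) {τ : Finset (Fin n)}
    (hτ : τ ∈ C.simplices) {j₁ : Fin n} (hj₁ : j₁ ∉ τ)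
    {α : (Fin n → ℂ) →ₗ[ℂ] (ℂ × (Fin m → ℂ))}
    (hα₀ : ∀ x y : Fin n → ℂ, (∀ j ∉ τ, x j = y j) → α x = α y)
    (hα : ∀ g, α (exponent Λ g) = g) :
    ∃ ε > 0, ε ≤ 1 / 4 ∧ ∀ y y' : Fin n → ℂ, α y = 0 → α y' = 0 → (∀ j ∉ τ, ‖y j‖ < ε) →
      (∀ j ∉ τ, ‖y' j‖ < ε) → ∀ g,
      (∀ j ∉ τ, expTwoPiI (y' j) = expTwoPiI (exponent Λ g j) * expTwoPiI (y j)) →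
      (∃ k : ℤ, g = (↑k, 0)) ∧ ∀ j ∉ τ, y' j = y j := by
  classical
  set R : (Fin n → ℝ) →ₗ[ℝ] (Fin n → ℂ) := Complex.ofRealCLM.toLinearMap.compLeft (Fin n) with hR
  have hRa : ∀ κ j, R κ j = (κ j : ℂ) := fun κ j => rfl
  set P : (Fin n → ℂ) →ₗ[ℂ] (Fin n → ℂ) :=
    LinearMap.pi fun j => if j ∈ τ then 0 else LinearMap.proj j with hP
  have hPa : ∀ x j, P x j = if j ∈ τ then 0 else x j := fun x j => by
    simp only [hP, LinearMap.pi_apply]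
    split_ifs <;> rfl
  set T : (Fin n → ℝ) →ₗ[ℝ] (Fin n → ℂ) × ℝ :=
    (R - (P ∘ₗ exponent Λ ∘ₗ α).restrictScalars ℝ ∘ₗ R).prod (LinearMap.proj j₁) with hT
  have hT1 : ∀ κ j, (T κ).1 j = κ j - if j ∈ τ then 0 else exponent Λ (α (R κ)) j :=
    fun κ j => by
      rw [← hPa]
      rfl
  have hT2 : ∀ κ, (T κ).2 = κ j₁ := fun κ => rfl
  have hinj : T.ker = ⊥ := by
    rw [LinearMap.ker_eq_bot']
    intro κ hκ
    have h1 : ∀ j, (κ j : ℂ) - (if j ∈ τ then 0 else exponent Λ (α (R κ)) j) = 0 := fun j => by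
      rw [← hT1, hκ]
      rfl
    have h2 : κ j₁ = 0 := by
      rw [← hT2 κ, hκ]
      rfl
    have h3 : ∀ j ∉ τ, exponent Λ (α (R κ)) j = κ j := fun j hj => by
      have := h1 j
      rw [if_neg hj] at this
      exact (sub_eq_zero.1 this).symm
    obtain ⟨-, h4⟩ := h.eq_zero_of_simplex hτ (g := α (R κ)) fun j hj => by
      rw [h3 j hj, Complex.ofReal_im]
    have h5 : ∀ j ∉ τ, (κ j : ℂ) = (α (R κ)).1 := fun j hj => by
      rw [← h3 j hj, exponent_apply, h4, dotProduct_zero, add_zero]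
    ext j
    by_cases hj : j ∈ τ
    · simpa [hj] using h1 j
    · have h6 := h5 j hj
      rw [← h5 j₁ hj₁, h2] at h6
      exact_mod_cast h6
  obtain ⟨K, hK, hanti⟩ := T.exists_antilipschitzWith hinj
  have hK' : (0 : ℝ) < K := hK
  refine ⟨min (1 / 4) (1 / (2 * K)), by positivity, min_le_left _ _, ?_⟩
  intro y y' hy hy' hys hys' g hg
  have hk : ∀ j, ∃ k : ℤ, j ∉ τ → y' j = exponent Λ g j + y j + k := fun j => by
    by_cases hj : j ∈ τ
    · exact ⟨0, fun h => absurd hj h⟩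
    · obtain ⟨k, hk⟩ := expTwoPiI_eq_iff.1 ((hg j hj).trans (expTwoPiI_add _ _).symm)
      exact ⟨k, fun _ => hk⟩
  choose k hk using hk
  set κ : Fin n → ℝ := fun j => if j ∈ τ then 0 else ((k j - k j₁ : ℤ) : ℝ) with hκ
  have hκj : ∀ j ∉ τ, (κ j : ℂ) = k j - k j₁ := fun j hj => by
    simp [hκ, hj]
  have hαg : α (R κ) = -(g + ((k j₁ : ℂ), 0)) := by
    have e1 : α (exponent Λ (g + ((k j₁ : ℂ), 0)) + R κ + y) = α y' := by
      refine hα₀ _ _ fun j hj => ?_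
      simp only [Pi.add_apply, hRa, hκj j hj, hk j hj, map_add]
      rw [exponent_apply Λ ((k j₁ : ℂ), 0), dotProduct_zero]
      ring
    rw [map_add, map_add, hα, hy, hy', add_zero] at e1
    rw [eq_neg_iff_add_eq_zero, add_comm, e1]
  have hdiff : ∀ j ∉ τ, (T κ).1 j = y' j - y j := fun j hj => by
    rw [hT1, if_neg hj, hαg, map_neg, map_add, hκj j hj, hk j hj]
    simp only [Pi.neg_apply, Pi.add_apply]
    rw [exponent_apply Λ ((k j₁ : ℂ), 0), dotProduct_zero]
    ring
  have hT0 : ‖T κ‖ < 1 / K := by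
    rw [Prod.norm_def, max_lt_iff]
    constructor
    · rw [pi_norm_lt_iff (by positivity)]
      intro j
      by_cases hj : j ∈ τ
      · rw [hT1, if_pos hj]
        simp [hκ, hj, hK']
      · rw [hdiff j hj]
        have e1 := (hys j hj).trans_le (min_le_right _ _)
        have e2 := (hys' j hj).trans_le (min_le_right _ _)
        have e3 : 1 / (K : ℝ) = 1 / (2 * K) + 1 / (2 * K) := by
          field_simp
          norm_num
        exact (norm_sub_le _ _).trans_lt (by rw [e3]; exact add_lt_add e2 e1)
    · rw [hT2]
      simp [hκ, hj₁, hK']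
  have hκ0 : κ = 0 := by
    have hle : ‖κ‖ ≤ K * ‖T κ‖ := hanti.le_mul_norm (map_zero T) κ
    have hlt : ‖κ‖ < 1 := hle.trans_lt (by
      calc K * ‖T κ‖ < K * (1 / K) := by gcongr
        _ = 1 := by field_simp)
    ext j
    by_cases hj : j ∈ τ
    · simp [hκ, hj]
    · have e1 := (norm_le_pi_norm κ j).trans_lt hlt
      simp only [hκ, if_neg hj, Real.norm_eq_abs, ← Int.cast_abs] at e1
      have e2 : |k j - k j₁| < 1 := by exact_mod_cast e1
      have e3 := Int.abs_lt_one_iff.1 e2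
      simp only [hκ, if_neg hj, e3, Int.cast_zero, Pi.zero_apply]
  constructor
  · refine ⟨-k j₁, ?_⟩
    rw [hκ0, map_zero, map_zero, eq_comm, neg_eq_zero] at hαg
    rw [eq_neg_of_add_eq_zero_left hαg]
    simp
  · intro j hj
    have := hdiff j hj
    rw [hκ0, map_zero] at this
    exact sub_eq_zero.1 this.symm

/-! ### Slices for the action -/

/-- A holomorphic slice for the action of `ℂ × ℂᵐ` on `U`: on the open set `W`, each point `z` is
brought by the inverse of `gauge z` to the point with parameter `retract z` of the slice, which is
parametrized by `param`; different parameters in `O` belong to different orbits. -/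
structure Slice (C : TriangulatedConfiguration E n) (Λ : Matrix (Fin n) (Fin m) ℂ) (k : ℕ) where
  O : Set (Fin k → ℂ)
  W : Set C.U
  param : (Fin k → ℂ) → C.U
  retract : C.U → Fin k → ℂ
  gauge : C.U → ℂ × (Fin m → ℂ)
  isOpen_O : IsOpen O
  isOpen_W : IsOpen W
  contMDiff_param : ContMDiff 𝓘(ℂ, Fin k → ℂ) 𝓘(ℂ, Fin n → ℂ) ω param
  contMDiffOn_retract : ContMDiffOn 𝓘(ℂ, Fin n → ℂ) 𝓘(ℂ, Fin k → ℂ) ω retract W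
  contMDiffOn_gauge : ContMDiffOn 𝓘(ℂ, Fin n → ℂ) 𝓘(ℂ, ℂ × (Fin m → ℂ)) ω gauge W
  retract_mem : ∀ z ∈ W, retract z ∈ O
  param_mem : ∀ y ∈ O, param y ∈ W
  retract_param : ∀ y ∈ O, retract (param y) = y
  actU_gauge : ∀ z ∈ W, C.actU Λ (gauge z) (param (retract z)) = z
  injOn : Set.InjOn (fun y => C.toLVMB Λ (param y)) O

/-- The logarithmic coordinates outside `τ` relative to the base point `z₀`. -/
def sliceLog (τ : Finset (Fin n)) (z₀ z : Fin n → ℂ) : Fin n → ℂ :=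
  fun j => if j ∈ τ then 0 else logTwoPiI (z j / z₀ j)

/-- The coordinates of the point of the slice in the orbit of `z`: the coordinates themselves in
`τ`, and their logarithms outside `τ`. -/
def sliceRetract (Λ : Matrix (Fin n) (Fin m) ℂ) (τ : Finset (Fin n)) (z₀ : Fin n → ℂ)
    (α : (Fin n → ℂ) →ₗ[ℂ] (ℂ × (Fin m → ℂ))) (z : Fin n → ℂ) : Fin n → ℂ :=
  fun j => if j ∈ τ then act Λ (-α (sliceLog τ z₀ z)) z j
    else sliceLog τ z₀ z j - exponent Λ (α (sliceLog τ z₀ z)) j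

/-- The point with given coordinates in `τ` and given logarithmic coordinates outside `τ`. -/
def sliceParam (τ : Finset (Fin n)) (z₀ y : Fin n → ℂ) : Fin n → ℂ :=
  fun j => if j ∈ τ then y j else expTwoPiI (y j) * z₀ j

theorem contDiff_sliceParam (τ : Finset (Fin n)) (z₀ : Fin n → ℂ) :
    ContDiff ℂ ω (sliceParam τ z₀) := by
  refine contDiff_pi.2 fun j => ?_
  by_cases hj : j ∈ τ
  · simpa [sliceParam, hj] using contDiff_apply ℂ ℂ j
  · simpa [sliceParam, hj] using
      (contDiff_expTwoPiI.comp (contDiff_apply ℂ ℂ j)).mul contDiff_const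

theorem contDiffAt_sliceLog {τ : Finset (Fin n)} {z₀ z : Fin n → ℂ}
    (hz : ∀ j ∉ τ, z j / z₀ j ∈ Complex.slitPlane) : ContDiffAt ℂ ω (sliceLog τ z₀) z := by
  refine contDiffAt_pi.2 fun j => ?_
  by_cases hj : j ∈ τ
  · simpa [sliceLog, hj] using contDiffAt_const
  · have h1 : ContDiffAt ℂ ω (fun z : Fin n → ℂ => logTwoPiI (z j / z₀ j)) z :=
      (contDiffAt_logTwoPiI (hz j hj)).comp z ((contDiff_apply ℂ ℂ j).contDiffAt.div_const _)
    simpa [sliceLog, hj] using h1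

theorem contDiffAt_sliceRetract {Λ : Matrix (Fin n) (Fin m) ℂ} {τ : Finset (Fin n)}
    {z₀ z : Fin n → ℂ} {α : (Fin n → ℂ) →ₗ[ℂ] (ℂ × (Fin m → ℂ))}
    (hz : ∀ j ∉ τ, z j / z₀ j ∈ Complex.slitPlane) :
    ContDiffAt ℂ ω (sliceRetract Λ τ z₀ α) z := by
  have hlog := contDiffAt_sliceLog hz
  have hα : ContDiffAt ℂ ω (fun z => α (sliceLog τ z₀ z)) z :=
    (LinearMap.toContinuousLinearMap α).contDiff.contDiffAt.comp z hlog
  refine contDiffAt_pi.2 fun j => ?_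
  have hexp : ContDiff ℂ ω fun g => exponent Λ g j := contDiff_weight (Λ j)
  by_cases hj : j ∈ τ
  · have h1 : ContDiffAt ℂ ω (fun z => expTwoPiI (exponent Λ (-α (sliceLog τ z₀ z)) j) * z j) z :=
      (contDiff_expTwoPiI.contDiffAt.comp z (hexp.contDiffAt.comp z hα.neg)).mul
        (contDiff_apply ℂ ℂ j).contDiffAt
    simpa [sliceRetract, hj, act_apply] using h1
  · have h1 : ContDiffAt ℂ ω
        (fun z => sliceLog τ z₀ z j - exponent Λ (α (sliceLog τ z₀ z)) j) z :=
      (contDiffAt_pi.1 hlog j).sub (hexp.contDiffAt.comp z hα)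
    simpa [sliceRetract, hj] using h1

theorem act_sliceParam_sliceRetract {Λ : Matrix (Fin n) (Fin m) ℂ} {τ : Finset (Fin n)}
    {z₀ z : Fin n → ℂ} (α : (Fin n → ℂ) →ₗ[ℂ] (ℂ × (Fin m → ℂ)))
    (hz : ∀ j ∉ τ, z j / z₀ j ∈ Complex.slitPlane) :
    act Λ (α (sliceLog τ z₀ z)) (sliceParam τ z₀ (sliceRetract Λ τ z₀ α z)) = z := by
  ext j
  by_cases hj : j ∈ τ
  · have h1 : sliceParam τ z₀ (sliceRetract Λ τ z₀ α z) j =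
        act Λ (-α (sliceLog τ z₀ z)) z j := by
      simp [sliceParam, sliceRetract, hj]
    rw [act_apply, h1, ← act_apply, act_act_neg]
  · have h0 := Complex.slitPlane_ne_zero (hz j hj)
    have h2 : z₀ j ≠ 0 := fun h => h0 (by simp [h])
    rw [act_apply, sliceParam, if_neg hj, sliceRetract, if_neg hj, ← mul_assoc, ← expTwoPiI_add,
      add_sub_cancel, sliceLog, if_neg hj, expTwoPiI_logTwoPiI h0, div_mul_cancel₀ _ h2]

theorem map_sliceRetract_eq_zero {Λ : Matrix (Fin n) (Fin m) ℂ} {τ : Finset (Fin n)}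
    {z₀ : Fin n → ℂ} {α : (Fin n → ℂ) →ₗ[ℂ] (ℂ × (Fin m → ℂ))}
    (hα₀ : ∀ x y : Fin n → ℂ, (∀ j ∉ τ, x j = y j) → α x = α y)
    (hα : ∀ g, α (exponent Λ g) = g) (z : Fin n → ℂ) : α (sliceRetract Λ τ z₀ α z) = 0 := by
  rw [hα₀ _ (sliceLog τ z₀ z - exponent Λ (α (sliceLog τ z₀ z))) fun j hj => by
    simp [sliceRetract, hj], map_sub, hα, sub_self]

theorem sliceParam_div_mem_slitPlane {τ : Finset (Fin n)} {z₀ y : Fin n → ℂ}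
    (hz₀ : ∀ j ∉ τ, z₀ j ≠ 0) (hy : ∀ j ∉ τ, ‖y j‖ < 1 / 4) :
    ∀ j ∉ τ, sliceParam τ z₀ y j / z₀ j ∈ Complex.slitPlane := by
  intro j hj
  have h1 := abs_lt.1 ((Complex.abs_re_le_norm (y j)).trans_lt (hy j hj))
  rw [sliceParam, if_neg hj, mul_div_cancel_right₀ _ (hz₀ j hj)]
  exact expTwoPiI_mem_slitPlane (by linarith) (by linarith)

theorem sliceRetract_sliceParam {Λ : Matrix (Fin n) (Fin m) ℂ} {τ : Finset (Fin n)}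
    {z₀ y : Fin n → ℂ} {α : (Fin n → ℂ) →ₗ[ℂ] (ℂ × (Fin m → ℂ))}
    (hα₀ : ∀ x y : Fin n → ℂ, (∀ j ∉ τ, x j = y j) → α x = α y)
    (hz₀ : ∀ j ∉ τ, z₀ j ≠ 0) (hy : ∀ j ∉ τ, ‖y j‖ < 1 / 4) (hαy : α y = 0) :
    sliceRetract Λ τ z₀ α (sliceParam τ z₀ y) = y := by
  have hlog : ∀ j ∉ τ, sliceLog τ z₀ (sliceParam τ z₀ y) j = y j := fun j hj => by
    have h1 := abs_lt.1 ((Complex.abs_re_le_norm (y j)).trans_lt (hy j hj))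
    rw [sliceLog, if_neg hj, sliceParam, if_neg hj, mul_div_cancel_right₀ _ (hz₀ j hj),
      logTwoPiI_expTwoPiI (by linarith) (by linarith)]
  have h0 : α (sliceLog τ z₀ (sliceParam τ z₀ y)) = 0 := (hα₀ _ _ hlog).trans hαy
  ext j
  by_cases hj : j ∈ τ
  · simp [sliceRetract, h0, hj, sliceParam]
  · simp [sliceRetract, h0, hj, hlog]

theorem contMDiffAt_comp_subtype_val {C : TriangulatedConfiguration E n} {F : Type*}
    [NormedAddCommGroup F] [NormedSpace ℂ F] {f : (Fin n → ℂ) → F} {z : C.U}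
    (hf : ContDiffAt ℂ ω f z.1) :
    ContMDiffAt 𝓘(ℂ, Fin n → ℂ) 𝓘(ℂ, F) ω (fun z : C.U => f z.1) z :=
  hf.contMDiffAt.comp z contMDiff_subtype_val.contMDiffAt

theorem contMDiffAt_of_subtype_val {C : TriangulatedConfiguration E n} {F H M : Type*}
    [NormedAddCommGroup F] [NormedSpace ℂ F] [TopologicalSpace H] {I : ModelWithCorners ℂ F H}
    [TopologicalSpace M] [ChartedSpace H M] {f : M → C.U} {x : M}
    (hf : ContMDiffAt I 𝓘(ℂ, Fin n → ℂ) ω (fun x => (f x).1) x) :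
    ContMDiffAt I 𝓘(ℂ, Fin n → ℂ) ω f x :=
  (ChartedSpace.liftPropWithinAt_subtypeVal_comp_iff ..).1 hf

theorem contMDiff_of_subtype_val {C : TriangulatedConfiguration E n} {F H M : Type*}
    [NormedAddCommGroup F] [NormedSpace ℂ F] [TopologicalSpace H] {I : ModelWithCorners ℂ F H}
    [TopologicalSpace M] [ChartedSpace H M] {f : M → C.U}
    (hf : ContMDiff I 𝓘(ℂ, Fin n → ℂ) ω (fun x => (f x).1)) :
    ContMDiff I 𝓘(ℂ, Fin n → ℂ) ω f :=
  fun x => contMDiffAt_of_subtype_val (hf x)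

/-- There is a slice through each point of `U`. -/
theorem IsAdmissible.exists_slice {C : TriangulatedConfiguration E n}
    {Λ : Matrix (Fin n) (Fin m) ℂ} (h : C.IsAdmissible Λ)
    (hn : n = Module.finrank ℝ E + m + (m + 1)) (z₀ : C.U) :
    ∃ S : C.Slice Λ (Module.finrank ℝ E + m), z₀ ∈ S.W ∧ S.param (S.retract z₀) = z₀ := by
  obtain ⟨τ, hτ, hc, hτz⟩ := mem_U_iff.1 z₀.2
  obtain ⟨j₁, hj₁⟩ : ∃ j, j ∉ τ := by
    by_contra! hall
    rw [Finset.eq_univ_iff_forall.2 hall] at hc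
    simp at hc
    omega
  obtain ⟨α, hα₀, hα⟩ := h.exists_gauge hτ hj₁
  obtain ⟨i, r, hri, hir, hαi⟩ := exists_slice_coordinates hn hα
  obtain ⟨ε, hε, hε4, hinj⟩ := h.exists_radius hτ hj₁ hα₀ hα
  have hic : Continuous i := (LinearMap.toContinuousLinearMap i).continuous
  have hparamU : ∀ y, sliceParam τ z₀.1 (i y) ∈ C.U := fun y =>
    mem_U_iff.2 ⟨τ, hτ, hc, fun j hj => by
      simp [sliceParam, hj, expTwoPiI_ne_zero, hτz j hj]⟩
  have hret : ∀ z, i (r (sliceRetract Λ τ z₀.1 α z)) = sliceRetract Λ τ z₀.1 α z := fun z =>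
    hir _ (map_sliceRetract_eq_zero hα₀ hα z)
  set D : Set C.U := {z | ∀ j ∉ τ, z.1 j / z₀.1 j ∈ Complex.slitPlane} with hD
  have hDo : IsOpen D := by
    have : D = ⋂ j ∈ τᶜ, {z : C.U | z.1 j / z₀.1 j ∈ Complex.slitPlane} := by
      ext z
      simp [hD]
    rw [this]
    exact isOpen_biInter_finset fun j _ => Complex.isOpen_slitPlane.preimage
      (((continuous_apply j).comp continuous_subtype_val).div_const _)
  have hz₀D : z₀ ∈ D := fun j hj => by
    rw [div_self (hτz j hj)]
    exact Complex.one_mem_slitPlane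
  set O : Set (Fin (Module.finrank ℝ E + m) → ℂ) := {y | ∀ j ∉ τ, ‖i y j‖ < ε} with hO
  have hOo : IsOpen O := by
    have : O = ⋂ j ∈ τᶜ, {y | ‖i y j‖ < ε} := by
      ext y
      simp [hO]
    rw [this]
    exact isOpen_biInter_finset fun j _ =>
      isOpen_lt ((continuous_apply j).comp hic).norm continuous_const
  set ρ : C.U → Fin (Module.finrank ℝ E + m) → ℂ :=
    fun z => r (sliceRetract Λ τ z₀.1 α z.1) with hρ
  have hρD : ContMDiffOn 𝓘(ℂ, Fin n → ℂ) 𝓘(ℂ, Fin (Module.finrank ℝ E + m) → ℂ) ω ρ D :=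
    fun z hz => (contMDiffAt_comp_subtype_val
      ((LinearMap.toContinuousLinearMap r).contDiff.contDiffAt.comp z.1
        (contDiffAt_sliceRetract hz))).contMDiffWithinAt
  set W : Set C.U := D ∩ ρ ⁻¹' O with hW
  have hs4 : ∀ y ∈ O, ∀ j ∉ τ, ‖i y j‖ < 1 / 4 := fun y hy j hj => (hy j hj).trans_le hε4
  have hρs : ∀ y ∈ O, ρ ⟨_, hparamU y⟩ = y := fun y hy => by
    simp only [hρ]
    rw [sliceRetract_sliceParam hα₀ hτz (hs4 y hy) (hαi y), hri]
  have hρ₀ : i (ρ z₀) = fun j => if j ∈ τ then z₀.1 j else 0 := by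
    have hl : sliceLog τ z₀.1 z₀.1 = 0 := by
      ext j
      by_cases hj : j ∈ τ
      · simp [sliceLog, hj]
      · simp [sliceLog, hj, div_self (hτz j hj)]
    simp only [hρ, hret]
    ext j
    by_cases hj : j ∈ τ <;> simp [sliceRetract, hj, hl]
  refine ⟨⟨O, W, fun y => ⟨_, hparamU y⟩, ρ, fun z => α (sliceLog τ z₀.1 z.1), hOo,
    hρD.continuousOn.isOpen_inter_preimage hDo hOo, ?_, hρD.mono Set.inter_subset_left, ?_,
    fun z hz => hz.2, fun y hy => ⟨?_, ?_⟩, hρs, ?_, ?_⟩, ⟨hz₀D, ?_⟩, ?_⟩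
  · refine contMDiff_of_subtype_val ?_
    exact ((contDiff_sliceParam τ z₀.1).comp
      (LinearMap.toContinuousLinearMap i).contDiff).contMDiff
  · exact fun z hz => (contMDiffAt_comp_subtype_val
      ((LinearMap.toContinuousLinearMap α).contDiff.contDiffAt.comp z.1
        (contDiffAt_sliceLog hz.1))).contMDiffWithinAt
  · exact sliceParam_div_mem_slitPlane hτz (hs4 y hy)
  · rw [Set.mem_preimage, hρs y hy]
    exact hy
  · intro z hz
    refine Subtype.ext ?_
    simp only [actU, hρ, hret]
    exact act_sliceParam_sliceRetract α hz.1
  · intro y hy y' hy' hyy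
    obtain ⟨g, hg⟩ := toLVMB_eq_iff.1 hyy
    simp only at hg
    obtain ⟨⟨k, rfl⟩, h2⟩ := hinj (i y) (i y') (hαi y) (hαi y') hy hy' g fun j hj => by
      have := congrFun hg j
      rw [act_apply, sliceParam, sliceParam, if_neg hj, if_neg hj, ← mul_assoc] at this
      exact mul_right_cancel₀ (hτz j hj) this
    rw [act_intCast] at hg
    rw [← hri y, ← hri y']
    congr 1
    ext j
    by_cases hj : j ∈ τ
    · simpa [sliceParam, hj] using (congrFun hg j).symm
    · exact (h2 j hj).symm
  · intro j hj
    simp [hρ₀, hj, hε]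
  · refine Subtype.ext ?_
    simp only [hρ₀]
    ext j
    by_cases hj : j ∈ τ <;> simp [sliceParam, hj]

/-! ### The complex structure of the quotient -/

theorem contMDiff_actU (C : TriangulatedConfiguration E n) (Λ : Matrix (Fin n) (Fin m) ℂ)
    (g : ℂ × (Fin m → ℂ)) : ContMDiff 𝓘(ℂ, Fin n → ℂ) 𝓘(ℂ, Fin n → ℂ) ω (C.actU Λ g) :=
  contMDiff_of_subtype_val fun _ => contMDiffAt_comp_subtype_val (contDiff_act Λ g).contDiffAt

namespace Slice

variable {C : TriangulatedConfiguration E n} {Λ : Matrix (Fin n) (Fin m) ℂ} {k : ℕ}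

theorem toLVMB_param_retract (S : C.Slice Λ k) {z : C.U} (hz : z ∈ S.W) :
    C.toLVMB Λ (S.param (S.retract z)) = C.toLVMB Λ z := by
  conv_rhs => rw [← S.actU_gauge z hz, toLVMB_actU]

theorem retract_eq (S : C.Slice Λ k) {z w : C.U} (hz : z ∈ S.W) (hw : w ∈ S.W)
    (h : C.toLVMB Λ z = C.toLVMB Λ w) : S.retract z = S.retract w :=
  S.injOn (S.retract_mem z hz) (S.retract_mem w hw) (by
    simp only [S.toLVMB_param_retract hz, S.toLVMB_param_retract hw, h])

/-- The inverse of the chart that a slice defines on the quotient is the parametrization of the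
slice followed by the projection. -/
def chart (S : C.Slice Λ k) : OpenPartialHomeomorph (C.LVMB Λ) (Fin k → ℂ) :=
  haveI : Nonempty C.U := ⟨S.param 0⟩
  have hinv : ∀ {z : C.U}, z ∈ S.W →
      S.retract (Function.invFunOn (C.toLVMB Λ) S.W (C.toLVMB Λ z)) = S.retract z := fun {z} hz =>
    have hex : ∃ w ∈ S.W, C.toLVMB Λ w = C.toLVMB Λ z := ⟨z, hz, rfl⟩
    S.retract_eq (Function.invFunOn_mem hex) hz (Function.invFunOn_eq hex)
  { toFun := fun q => S.retract (Function.invFunOn (C.toLVMB Λ) S.W q)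
    invFun := fun y => C.toLVMB Λ (S.param y)
    source := C.toLVMB Λ '' S.W
    target := S.O
    map_source' := by
      rintro _ ⟨z, hz, rfl⟩
      rw [hinv hz]
      exact S.retract_mem z hz
    map_target' := fun y hy => ⟨_, S.param_mem y hy, rfl⟩
    left_inv' := by
      rintro _ ⟨z, hz, rfl⟩
      rw [hinv hz, S.toLVMB_param_retract hz]
    right_inv' := fun y hy => by rw [hinv (S.param_mem y hy), S.retract_param y hy]
    open_source := C.isOpenMap_toLVMB Λ _ S.isOpen_W
    open_target := S.isOpen_O
    continuousOn_toFun := by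
      rintro _ ⟨z, hz, rfl⟩
      refine ContinuousAt.continuousWithinAt ?_
      rw [← (C.isOpenQuotientMap_toLVMB Λ).continuousAt_comp_iff]
      refine ((S.contMDiffOn_retract.contMDiffAt (S.isOpen_W.mem_nhds hz)).continuousAt).congr ?_
      filter_upwards [S.isOpen_W.mem_nhds hz] with w hw
      exact (hinv hw).symm
    continuousOn_invFun :=
      ((C.continuous_toLVMB Λ).comp S.contMDiff_param.continuous).continuousOn }

theorem chart_toLVMB (S : C.Slice Λ k) {z : C.U} (hz : z ∈ S.W) :
    S.chart (C.toLVMB Λ z) = S.retract z := by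
  rw [← S.toLVMB_param_retract hz]
  exact S.chart.right_inv (S.retract_mem z hz)

/-- A point whose orbit meets the domain of the slice is moved into it by a group element. -/
theorem exists_actU_mem (S : C.Slice Λ k) {z : C.U} (hz : C.toLVMB Λ z ∈ S.chart.source) :
    ∃ g, C.actU Λ g z ∈ S.W := by
  obtain ⟨w, hw, hwz⟩ := hz
  obtain ⟨g, hg⟩ := toLVMB_eq_iff.1 hwz.symm
  exact ⟨g, by rwa [show C.actU Λ g z = w from Subtype.ext hg.symm]⟩

theorem contMDiffAt_chart_toLVMB (S : C.Slice Λ k) {z : C.U}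
    (hz : C.toLVMB Λ z ∈ S.chart.source) :
    ContMDiffAt 𝓘(ℂ, Fin n → ℂ) 𝓘(ℂ, Fin k → ℂ) ω (fun z => S.chart (C.toLVMB Λ z)) z := by
  obtain ⟨g, hg⟩ := S.exists_actU_mem hz
  have h1 : ContMDiffAt 𝓘(ℂ, Fin n → ℂ) 𝓘(ℂ, Fin k → ℂ) ω (S.retract ∘ C.actU Λ g) z :=
    (S.contMDiffOn_retract.contMDiffAt (S.isOpen_W.mem_nhds hg)).comp z
      (C.contMDiff_actU Λ g).contMDiffAt
  refine h1.congr_of_eventuallyEq ?_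
  filter_upwards [(C.continuous_actU Λ g).continuousAt.preimage_mem_nhds (S.isOpen_W.mem_nhds hg)]
    with w hw
  rw [Function.comp_apply, ← S.chart_toLVMB hw, toLVMB_actU]

/-- Over the chart of a slice there are nonvanishing holomorphic functions transforming according to
any given character of the group: the value at a point is the character of the group element which
carries the parametrized slice point of its orbit to it. -/
theorem exists_equivariant (S : C.Slice Λ k) (h : C.IsAdmissible Λ)
    (hn : Module.finrank ℝ E < n) (l : Fin m → ℂ) :
    ∃ χ : C.U → ℂ, (∀ z, χ z ≠ 0) ∧
      (∀ z, C.toLVMB Λ z ∈ S.chart.source →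
        ContMDiffAt 𝓘(ℂ, Fin n → ℂ) 𝓘(ℂ, ℂ) ω χ z) ∧
      ∀ z, C.toLVMB Λ z ∈ S.chart.source → ∀ g,
        χ (C.actU Λ g z) = expTwoPiI (weight l g) * χ z := by
  classical
  have hex : ∀ z : C.U, ∃ g, C.toLVMB Λ z ∈ S.chart.source →
      C.actU Λ g (S.param (S.chart (C.toLVMB Λ z))) = z := by
    intro z
    by_cases hz : C.toLVMB Λ z ∈ S.chart.source
    · have h1 : C.toLVMB Λ (S.param (S.chart (C.toLVMB Λ z))) = C.toLVMB Λ z :=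
        S.chart.left_inv hz
      obtain ⟨g, hg⟩ := toLVMB_eq_iff.1 h1
      exact ⟨g, fun _ => Subtype.ext hg.symm⟩
    · exact ⟨0, fun h => absurd h hz⟩
  choose G hG using hex
  have huniq : ∀ {g g' : ℂ × (Fin m → ℂ)} {w : C.U}, C.actU Λ g w = C.actU Λ g' w →
      expTwoPiI (weight l g) = expTwoPiI (weight l g') := by
    intro g g' w hw
    have h1 : act Λ (g - g') w.1 = w.1 := by
      rw [sub_eq_neg_add, act_add, show act Λ g w.1 = act Λ g' w.1 from congrArg Subtype.val hw,
        act_neg_act]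
    obtain ⟨k, hk⟩ := h.act_eq_self hn w.2 h1
    refine expTwoPiI_eq_iff.2 ⟨k, ?_⟩
    rw [eq_add_of_sub_eq hk, map_add, weight_apply l ((k : ℂ), 0)]
    simp [add_comm]
  refine ⟨fun z => expTwoPiI (weight l (G z)), fun z => expTwoPiI_ne_zero _, fun z hz => ?_,
    fun z hz g => ?_⟩
  · obtain ⟨g, hg⟩ := S.exists_actU_mem hz
    have hgauge : ContMDiffAt 𝓘(ℂ, Fin n → ℂ) 𝓘(ℂ, ℂ × (Fin m → ℂ)) ω
        (fun w => S.gauge (C.actU Λ g w)) z :=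
      (S.contMDiffOn_gauge.contMDiffAt (S.isOpen_W.mem_nhds hg)).comp z
        (C.contMDiff_actU Λ g).contMDiffAt
    have hchar : ContDiff ℂ ω fun x => expTwoPiI (weight l (-g + x)) :=
      contDiff_expTwoPiI.comp ((contDiff_weight l).comp (contDiff_const.add contDiff_id))
    have h1 : ContMDiffAt 𝓘(ℂ, Fin n → ℂ) 𝓘(ℂ, ℂ) ω
        (fun w => expTwoPiI (weight l (-g + S.gauge (C.actU Λ g w)))) z :=
      hchar.contMDiff.contMDiffAt.comp z hgauge
    refine h1.congr_of_eventuallyEq ?_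
    filter_upwards [(C.continuous_actU Λ g).continuousAt.preimage_mem_nhds
      (S.isOpen_W.mem_nhds hg)] with w hw
    have hws : C.toLVMB Λ w ∈ S.chart.source := ⟨_, hw, by simp⟩
    refine huniq (w := S.param (S.chart (C.toLVMB Λ w))) ?_
    rw [hG w hws]
    have h2 := S.actU_gauge _ hw
    rw [← S.chart_toLVMB hw, toLVMB_actU] at h2
    refine Subtype.ext ?_
    have h3 := congrArg Subtype.val h2
    simp only [actU] at h3 ⊢
    rw [act_add, h3, act_neg_act]
  · have hz' : C.toLVMB Λ (C.actU Λ g z) ∈ S.chart.source := by rwa [toLVMB_actU]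
    simp only
    rw [← expTwoPiI_add, ← map_add]
    refine huniq (w := S.param (S.chart (C.toLVMB Λ z))) ?_
    have h1 := hG _ hz'
    rw [toLVMB_actU] at h1
    rw [h1]
    refine Subtype.ext ?_
    have h2 := congrArg Subtype.val (hG z hz)
    simp only [actU] at h2 ⊢
    rw [act_add, h2]

/-- The complex structure on the quotient defined by a family of slices. -/
abbrev chartedSpace (S : C.U → C.Slice Λ k) (hS : ∀ z, z ∈ (S z).W) :
    ChartedSpace (Fin k → ℂ) (C.LVMB Λ) where
  atlas := Set.range fun z => (S z).chart
  chartAt q := (S (Function.surjInv (C.surjective_toLVMB Λ) q)).chart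
  mem_chart_source q := ⟨_, hS _, Function.surjInv_eq _ q⟩
  chart_mem_atlas _ := ⟨_, rfl⟩

theorem isComplexStructure (S : C.U → C.Slice Λ k) (hS : ∀ z, z ∈ (S z).W)
    (hS' : ∀ z, (S z).param ((S z).retract z) = z) (h : C.IsAdmissible Λ)
    (hbal : C.IsBalanced) : C.IsComplexStructure Λ (chartedSpace S hS) := by
  let := chartedSpace S hS
  have hman : IsManifold 𝓘(ℂ, Fin k → ℂ) ω (C.LVMB Λ) := by
    refine isManifold_of_contDiffOn _ _ _ fun e e' he he' => ?_
    obtain ⟨z, rfl⟩ := he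
    obtain ⟨z', rfl⟩ := he'
    simp only [modelWithCornersSelf_coe, modelWithCornersSelf_coe_symm, Function.comp_id,
      Function.id_comp, Set.preimage_id, Set.range_id, Set.inter_univ]
    intro y hy
    rw [OpenPartialHomeomorph.trans_source] at hy
    have h1 : ContMDiffAt 𝓘(ℂ, Fin k → ℂ) 𝓘(ℂ, Fin k → ℂ) ω
        (fun y => (S z').chart (C.toLVMB Λ ((S z).param y))) y :=
      ((S z').contMDiffAt_chart_toLVMB hy.2).comp y (S z).contMDiff_param.contMDiffAt
    exact h1.contDiffAt.contDiffWithinAt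
  have hatlas : ∀ z, (S z).chart ∈ IsManifold.maximalAtlas 𝓘(ℂ, Fin k → ℂ) ω (C.LVMB Λ) :=
    fun z => IsManifold.subset_maximalAtlas ⟨z, rfl⟩
  refine ⟨h.t2Space, h.compactSpace hbal, hman, fun z => ?_, fun z => ?_⟩
  · have h1 : ContMDiffAt 𝓘(ℂ, Fin k → ℂ) 𝓘(ℂ, Fin k → ℂ) ω (S z).chart.symm
        ((S z).retract z) :=
      (contMDiffOn_symm_of_mem_maximalAtlas (hatlas z)).contMDiffAt
        ((S z).isOpen_O.mem_nhds ((S z).retract_mem z (hS z)))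
    have h2 := h1.comp z ((S z).contMDiffOn_retract.contMDiffAt ((S z).isOpen_W.mem_nhds (hS z)))
    refine h2.congr_of_eventuallyEq ?_
    filter_upwards [(S z).isOpen_W.mem_nhds (hS z)] with w hw
    exact ((S z).toLVMB_param_retract hw).symm
  · refine ⟨(S z).chart.source, fun q => (S z).param ((S z).chart q), (S z).chart.open_source,
      ⟨z, hS z, rfl⟩, ?_, ?_, fun q hq => (S z).chart.left_inv hq⟩
    · exact (S z).contMDiff_param.comp_contMDiffOn (contMDiffOn_of_mem_maximalAtlas (hatlas z))
    · simp only [(S z).chart_toLVMB (hS z), hS']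

end Slice

theorem IsAdmissible.exists_isComplexStructure {C : TriangulatedConfiguration E n}
    {Λ : Matrix (Fin n) (Fin m) ℂ} (h : C.IsAdmissible Λ)
    (hn : n = Module.finrank ℝ E + (2 * m + 1)) (hbal : C.IsBalanced) :
    ∃ cN : ChartedSpace (Fin (Module.finrank ℝ E + m) → ℂ) (C.LVMB Λ),
      C.IsComplexStructure Λ cN := by
  choose S hS using h.exists_slice (by omega)
  exact ⟨_, Slice.isComplexStructure S (fun z => (hS z).1) (fun z => (hS z).2) h hbal⟩

/-- Near each point of the quotient there are nonvanishing holomorphic functions on `U` transforming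
according to any given character of the group. -/
theorem IsAdmissible.exists_equivariant {C : TriangulatedConfiguration E n}
    {Λ : Matrix (Fin n) (Fin m) ℂ} (h : C.IsAdmissible Λ)
    (hn : n = Module.finrank ℝ E + (2 * m + 1)) (l : Fin m → ℂ) (q : C.LVMB Λ) :
    ∃ (W : Set (C.LVMB Λ)) (χ : C.U → ℂ), IsOpen W ∧ q ∈ W ∧ (∀ z, χ z ≠ 0) ∧
      (∀ z, C.toLVMB Λ z ∈ W → ContMDiffAt 𝓘(ℂ, Fin n → ℂ) 𝓘(ℂ, ℂ) ω χ z) ∧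
      ∀ z, C.toLVMB Λ z ∈ W → ∀ g, χ (C.actU Λ g z) = expTwoPiI (weight l g) * χ z := by
  obtain ⟨z, rfl⟩ := C.surjective_toLVMB Λ q
  obtain ⟨S, hS, -⟩ := h.exists_slice (by omega) z
  obtain ⟨χ, h1, h2, h3⟩ := S.exists_equivariant h (by omega) l
  exact ⟨S.chart.source, χ, S.chart.open_source, ⟨z, hS, rfl⟩, h1, h2, h3⟩

end TriangulatedConfiguration

/-! ### Maps with local sections -/

section LocalSections

variable {F₁ F₂ F₃ F₄ H₁ H₂ H₃ H₄ : Type*} [NormedAddCommGroup F₁] [NormedSpace ℂ F₁]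
  [NormedAddCommGroup F₂] [NormedSpace ℂ F₂] [NormedAddCommGroup F₃] [NormedSpace ℂ F₃]
  [NormedAddCommGroup F₄] [NormedSpace ℂ F₄] [TopologicalSpace H₁] [TopologicalSpace H₂]
  [TopologicalSpace H₃] [TopologicalSpace H₄]
  {I₁ : ModelWithCorners ℂ F₁ H₁} {I₂ : ModelWithCorners ℂ F₂ H₂}
  {I₃ : ModelWithCorners ℂ F₃ H₃} {I₄ : ModelWithCorners ℂ F₄ H₄}
  {X Y Z Z' : Type*} [TopologicalSpace X] [ChartedSpace H₁ X] [TopologicalSpace Y]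
  [ChartedSpace H₂ Y] [TopologicalSpace Z] [ChartedSpace H₃ Z] [TopologicalSpace Z']
  [ChartedSpace H₄ Z']

variable (I₁ I₂) in
/-- The map `q` has a holomorphic section near each point of its target. -/
def HasLocalSections (q : X → Y) : Prop :=
  ∀ y, ∃ s : Y → X, ContMDiffAt I₂ I₁ ω s y ∧ ∀ᶠ y' in 𝓝 y, q (s y') = y'

/-- A map is holomorphic if its composition with a map with local sections is. -/
theorem HasLocalSections.contMDiffAt {q : X → Y} (hq : HasLocalSections I₁ I₂ q) {f : Y → Z}
    {y : Y} (hf : ∀ x, q x = y → ContMDiffAt I₁ I₃ ω (fun x => f (q x)) x) :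
    ContMDiffAt I₂ I₃ ω f y := by
  obtain ⟨s, hs, hqs⟩ := hq y
  refine ((hf (s y) hqs.self_of_nhds).comp y hs).congr_of_eventuallyEq ?_
  filter_upwards [hqs] with y' hy'
  rw [Function.comp_apply, hy']

theorem HasLocalSections.prodMap {q : X → Y} (hq : HasLocalSections I₁ I₂ q) {q' : Z → Z'}
    (hq' : HasLocalSections I₃ I₄ q') :
    HasLocalSections (I₁.prod I₃) (I₂.prod I₄) (Prod.map q q') := by
  rintro ⟨y, y'⟩
  obtain ⟨s, hs, hqs⟩ := hq y
  obtain ⟨s', hs', hqs'⟩ := hq' y'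
  refine ⟨Prod.map s s', hs.prodMap' hs', ?_⟩
  rw [nhds_prod_eq]
  filter_upwards [hqs.prod_mk hqs'] with x hx
  exact Prod.ext hx.1 hx.2

end LocalSections

namespace TriangulatedConfiguration

variable {E : Type*} [AddCommGroup E] [Module ℝ E] {n m : ℕ}

theorem IsComplexStructure.hasLocalSections {C : TriangulatedConfiguration E n}
    {Λ : Matrix (Fin n) (Fin m) ℂ} {k : ℕ} {cN : ChartedSpace (Fin k → ℂ) (C.LVMB Λ)}
    (h : C.IsComplexStructure Λ cN) :
    HasLocalSections 𝓘(ℂ, Fin n → ℂ) 𝓘(ℂ, Fin k → ℂ) (C.toLVMB Λ) := by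
  intro q
  obtain ⟨z, rfl⟩ := C.surjective_toLVMB Λ q
  obtain ⟨W, s, hW, hz, hs, -, hsq⟩ := h.exists_local_section z
  exact ⟨s, hs.contMDiffAt (hW.mem_nhds hz), mem_of_superset (hW.mem_nhds hz) hsq⟩

end TriangulatedConfiguration

/-! ### The projection of `ℂ` onto an elliptic curve -/

theorem mk_eq_mk_iff {τ : ℍ} {x y : ℂ} :
    (x : EllipticCurveOfPeriod τ) = y ↔ ∃ a b : ℤ, y = x + a + b * τ := by
  rw [QuotientAddGroup.eq, periodLattice, AddSubgroup.mem_closure_pair]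
  refine exists_congr fun a => exists_congr fun b => ?_
  simp only [zsmul_eq_mul, mul_one]
  constructor <;> intro h <;> linear_combination -h

theorem hasLocalSections_mk (τ : ℍ) :
    HasLocalSections 𝓘(ℂ, ℂ) 𝓘(ℂ, ℂ) ((↑) : ℂ → EllipticCurveOfPeriod τ) := by
  intro q
  refine ⟨chartAt ℂ q, contMDiffAt_of_mem_maximalAtlas (IsManifold.chart_mem_maximalAtlas q)
    (mem_chart_source ℂ q), ?_⟩
  filter_upwards [(chartAt ℂ q).open_source.mem_nhds (mem_chart_source ℂ q)] with x hx
  rw [← mk_symm_chart τ _ (chart_mem_atlas ℂ q), (chartAt ℂ q).left_inv hx]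

theorem contMDiff_mk (τ : ℍ) :
    ContMDiff 𝓘(ℂ, ℂ) 𝓘(ℂ, ℂ) ω ((↑) : ℂ → EllipticCurveOfPeriod τ) := by
  intro x
  set e := chartAt ℂ (x : EllipticCurveOfPeriod τ) with he
  have hx : (x : EllipticCurveOfPeriod τ) ∈ e.source := mem_chart_source ℂ _
  have hmk : ∀ y, e.symm y = (y : EllipticCurveOfPeriod τ) :=
    mk_symm_chart τ e (chart_mem_atlas ℂ _)
  -- the chart is the inverse of a translate of the projection near `x`
  set d := e (x : EllipticCurveOfPeriod τ) - x with hd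
  have hdx : ∀ y : ℂ, ((y + d : ℂ) : EllipticCurveOfPeriod τ) = y := by
    have h1 : ((x + d : ℂ) : EllipticCurveOfPeriod τ) = x := by
      rw [← hmk, hd, add_sub_cancel, e.left_inv hx]
    intro y
    rw [QuotientAddGroup.mk_add] at h1 ⊢
    rw [add_eq_left.1 h1, add_zero]
  have h1 : ContMDiffAt 𝓘(ℂ, ℂ) 𝓘(ℂ, ℂ) ω e.symm (x + d) := by
    refine contMDiffAt_symm_of_mem_maximalAtlas (IsManifold.chart_mem_maximalAtlas _) ?_
    rw [hd, add_sub_cancel]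
    exact e.map_source hx
  have h2 : ContMDiffAt 𝓘(ℂ, ℂ) 𝓘(ℂ, ℂ) ω (fun y : ℂ => y + d) x :=
    (contDiff_id.add contDiff_const).contMDiff.contMDiffAt
  refine (h1.comp x h2).congr_of_eventuallyEq (Eventually.of_forall fun y => ?_)
  rw [Function.comp_apply, hmk, hdx]

/-- The map `(exp(2πix), exp(2πiy)) ↦ x - τ y` from `ℂˣ × ℂˣ` to `ℂ / (ℤ + ℤτ)`. -/
def ellipticLog (τ : ℍ) (p : ℂ × ℂ) : EllipticCurveOfPeriod τ :=
  ((logTwoPiI p.1 - τ * logTwoPiI p.2 : ℂ) : EllipticCurveOfPeriod τ)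

theorem ellipticLog_eq (τ : ℍ) {p : ℂ × ℂ} {x y : ℂ} (hx : expTwoPiI x = p.1)
    (hy : expTwoPiI y = p.2) : ellipticLog τ p = ((x - τ * y : ℂ) : EllipticCurveOfPeriod τ) := by
  have h1 := expTwoPiI_logTwoPiI (hx ▸ expTwoPiI_ne_zero x)
  have h2 := expTwoPiI_logTwoPiI (hy ▸ expTwoPiI_ne_zero y)
  obtain ⟨a, ha⟩ := expTwoPiI_eq_iff.1 (hx.trans h1.symm)
  obtain ⟨b, hb⟩ := expTwoPiI_eq_iff.1 (hy.trans h2.symm)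
  rw [ellipticLog, mk_eq_mk_iff]
  refine ⟨a, -b, ?_⟩
  rw [ha, hb]
  push_cast
  ring

theorem contMDiffAt_ellipticLog (τ : ℍ) {p : ℂ × ℂ} (h1 : p.1 ≠ 0) (h2 : p.2 ≠ 0) :
    ContMDiffAt 𝓘(ℂ, ℂ × ℂ) 𝓘(ℂ, ℂ) ω (ellipticLog τ) p := by
  have hlog : ContDiffAt ℂ ω (fun x : ℂ × ℂ => (logTwoPiI (x.1 / p.1) + logTwoPiI p.1)
      - τ * (logTwoPiI (x.2 / p.2) + logTwoPiI p.2)) p := by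
    have e1 : ContDiffAt ℂ ω (fun x : ℂ × ℂ => logTwoPiI (x.1 / p.1)) p :=
      (contDiffAt_logTwoPiI (by
        rw [div_self h1]
        exact Complex.one_mem_slitPlane)).comp p (contDiffAt_fst.div_const p.1)
    have e2 : ContDiffAt ℂ ω (fun x : ℂ × ℂ => logTwoPiI (x.2 / p.2)) p :=
      (contDiffAt_logTwoPiI (by
        rw [div_self h2]
        exact Complex.one_mem_slitPlane)).comp p (contDiffAt_snd.div_const p.2)
    exact (e1.add contDiffAt_const).sub (contDiffAt_const.mul (e2.add contDiffAt_const))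
  refine ((contMDiff_mk τ).contMDiffAt.comp p hlog.contMDiffAt).congr_of_eventuallyEq ?_
  filter_upwards [continuous_fst.continuousAt.eventually_ne h1,
    continuous_snd.continuousAt.eventually_ne h2] with x hx1 hx2
  refine ellipticLog_eq τ ?_ ?_
  · rw [expTwoPiI_add, expTwoPiI_logTwoPiI (div_ne_zero hx1 h1), expTwoPiI_logTwoPiI h1,
      div_mul_cancel₀ _ h1]
  · rw [expTwoPiI_add, expTwoPiI_logTwoPiI (div_ne_zero hx2 h2), expTwoPiI_logTwoPiI h2,
      div_mul_cancel₀ _ h2]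

namespace TriangulatedConfiguration

variable {E : Type*} [AddCommGroup E] [Module ℝ E] {n m : ℕ}

/-! ### The exponents of the enlarged configuration -/

/-- The exponents of the enlarged configuration: the rows `(1, l)` and `(τ, l)` of the two ghost
vectors, followed by the rows `(0, Λⱼ)`. -/
def prependRows (τ : ℍ) (l : Fin m → ℂ) (Λ : Matrix (Fin n) (Fin m) ℂ) :
    Matrix (Fin (n + 2)) (Fin (m + 1)) ℂ :=
  Matrix.vecCons (Matrix.vecCons 1 l)
    (Matrix.vecCons (Matrix.vecCons (τ : ℂ) l) fun j => Matrix.vecCons 0 (Λ j))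

section Exponents

variable (τ : ℍ) (l : Fin m → ℂ) (Λ : Matrix (Fin n) (Fin m) ℂ) (g : ℂ × (Fin m → ℂ)) (v : ℂ)

theorem exponent_prependRows_zero :
    exponent (prependRows τ l Λ) (g.1, Matrix.vecCons v g.2) 0 = weight l g + v := by
  change g.1 + Matrix.vecCons 1 l ⬝ᵥ Matrix.vecCons v g.2 = _
  simp [weight_apply]
  ring

theorem exponent_prependRows_one :
    exponent (prependRows τ l Λ) (g.1, Matrix.vecCons v g.2) 1 = weight l g + τ * v := by
  change g.1 + Matrix.vecCons (τ : ℂ) l ⬝ᵥ Matrix.vecCons v g.2 = _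
  simp [weight_apply]
  ring

theorem exponent_prependRows_succ (j : Fin n) :
    exponent (prependRows τ l Λ) (g.1, Matrix.vecCons v g.2) j.succ.succ = exponent Λ g j := by
  change g.1 + Matrix.vecCons 0 (Λ j) ⬝ᵥ Matrix.vecCons v g.2 = _
  simp [exponent_apply]

end Exponents

theorem exists_eq_vecCons (g : ℂ × (Fin (m + 1) → ℂ)) :
    ∃ (h : ℂ × (Fin m → ℂ)) (v : ℂ), g = (h.1, Matrix.vecCons v h.2) :=
  ⟨(g.1, Matrix.vecTail g.2), Matrix.vecHead g.2, by simp⟩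

theorem mem_relations_prependTwoZeros {C : TriangulatedConfiguration E n} {r : Fin (n + 2) → ℝ} :
    r ∈ C.prependTwoZeros.relations ↔ (fun j : Fin n => r j.succ.succ) ∈ C.relations := by
  rw [mem_relations_iff, mem_relations_iff]
  simp [prependTwoZeros, Fin.sum_univ_succ]

theorem IsAdmissible.prependTwoZeros {C : TriangulatedConfiguration E n}
    {Λ : Matrix (Fin n) (Fin m) ℂ} (h : C.IsAdmissible Λ) (τ : ℍ) (l : Fin m → ℂ) :
    C.prependTwoZeros.IsAdmissible (prependRows τ l Λ) := by
  refine ⟨fun g => ?_, fun r hr => ?_, fun g hg => ?_⟩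
  · obtain ⟨g, v, rfl⟩ := exists_eq_vecCons g
    rw [mem_relations_prependTwoZeros]
    simp only [exponent_prependRows_succ]
    exact h.im_mem g
  · obtain ⟨g, hg⟩ := h.exists_im_eq _ (mem_relations_prependTwoZeros.1 hr)
    -- `Im v` and `Im (τ v)` can be prescribed since `Im τ ≠ 0`
    set a := r 0 - (weight l g).im with ha
    set b := r 1 - (weight l g).im with hb
    refine ⟨(g.1, Matrix.vecCons ⟨(b - τ.re * a) / τ.im, a⟩ g.2), fun j => ?_⟩
    refine Fin.cases ?_ (fun j => ?_) j
    · rw [exponent_prependRows_zero]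
      simp [ha]
    · refine Fin.cases ?_ (fun j => ?_) j
      · have h1 := τ.im_ne_zero
        rw [Fin.succ_zero_eq_one, exponent_prependRows_one]
        simp only [Complex.add_im, Complex.mul_im, UpperHalfPlane.coe_re, UpperHalfPlane.coe_im]
        rw [mul_div_cancel₀ _ h1, hb]
        ring
      · rw [exponent_prependRows_succ, hg]
  · obtain ⟨g, v, rfl⟩ := exists_eq_vecCons g
    obtain ⟨h1, h2⟩ := h.eq_zero g fun j => by
      rw [← exponent_prependRows_succ τ l Λ g v]
      exact hg _
    have h3 : (weight l g).im = 0 := by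
      rw [weight_apply, h2, dotProduct_zero, add_zero, h1]
    have h4 := hg 0
    have h5 := hg 1
    rw [exponent_prependRows_zero, Complex.add_im, h3, zero_add] at h4
    rw [exponent_prependRows_one, Complex.add_im, h3, zero_add, Complex.mul_im, h4, mul_zero,
      zero_add, UpperHalfPlane.coe_im] at h5
    have hv : v = 0 := Complex.ext ((mul_eq_zero.1 h5).resolve_left τ.im_ne_zero) h4
    refine ⟨h1, ?_⟩
    simp only
    rw [hv, h2]
    simp

/-! ### The points of the enlarged open set -/

theorem mem_U_prependTwoZeros {C : TriangulatedConfiguration E n} {z : Fin (n + 2) → ℂ} :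
    z ∈ C.prependTwoZeros.U ↔ z 0 ≠ 0 ∧ z 1 ≠ 0 ∧ (fun j : Fin n => z j.succ.succ) ∈ C.U := by
  simp only [mem_U_iff]
  constructor
  · rintro ⟨_, ⟨τ, hτ, rfl⟩, hc, h⟩
    refine ⟨h 0 fun h0 => ?_, h 1 fun h0 => ?_, τ, hτ, by simpa using hc, fun j hj =>
      h _ fun h0 => ?_⟩
    · obtain ⟨j, -, hj⟩ := Finset.mem_map.1 h0
      exact absurd hj (Fin.succ_ne_zero j.succ)
    · obtain ⟨j, -, hj⟩ := Finset.mem_map.1 h0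
      rw [shiftTwo_apply, ← Fin.succ_zero_eq_one] at hj
      exact absurd (Fin.succ_injective _ hj) (Fin.succ_ne_zero _)
    · obtain ⟨i, hi, hij⟩ := Finset.mem_map.1 h0
      rw [← (shiftTwo n).injective hij] at hj
      exact hj hi
  · rintro ⟨h0, h1, τ, hτ, hc, h⟩
    refine ⟨τ.map (shiftTwo n), ⟨τ, hτ, rfl⟩, by simpa using hc, fun j => ?_⟩
    refine Fin.cases (fun _ => h0) (fun j => ?_) j
    refine Fin.cases (fun _ => h1) (fun j hj => ?_) j
    exact h j fun hjτ => hj (Finset.mem_map.2 ⟨j, hjτ, rfl⟩)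

/-- The point `(a, b, z)` of the open set of the enlarged configuration. -/
def consU {C : TriangulatedConfiguration E n} (a b : ℂ) (ha : a ≠ 0) (hb : b ≠ 0) (z : C.U) :
    C.prependTwoZeros.U :=
  ⟨Matrix.vecCons a (Matrix.vecCons b z.1), mem_U_prependTwoZeros.2 ⟨ha, hb, z.2⟩⟩

/-- The projection `(a, b, z) ↦ z`. -/
def tailU {C : TriangulatedConfiguration E n} (z : C.prependTwoZeros.U) : C.U :=
  ⟨fun j => z.1 j.succ.succ, (mem_U_prependTwoZeros.1 z.2).2.2⟩

@[simp]
theorem tailU_consU {C : TriangulatedConfiguration E n} (a b : ℂ) (ha : a ≠ 0) (hb : b ≠ 0)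
    (z : C.U) : tailU (consU a b ha hb z) = z := rfl

theorem consU_tailU {C : TriangulatedConfiguration E n} (z : C.prependTwoZeros.U) :
    consU (z.1 0) (z.1 1) (mem_U_prependTwoZeros.1 z.2).1 (mem_U_prependTwoZeros.1 z.2).2.1
      (tailU z) = z := by
  refine Subtype.ext (funext fun j => ?_)
  refine Fin.cases rfl (fun j => ?_) j
  exact Fin.cases rfl (fun j => rfl) j

theorem exists_eq_consU {C : TriangulatedConfiguration E n} (z : C.prependTwoZeros.U) :
    ∃ a b ha hb w, z = consU a b ha hb w :=
  ⟨_, _, _, _, _, (consU_tailU z).symm⟩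

theorem contMDiff_tailU {C : TriangulatedConfiguration E n} :
    ContMDiff 𝓘(ℂ, Fin (n + 2) → ℂ) 𝓘(ℂ, Fin n → ℂ) ω (tailU (C := C)) := by
  have h : ContDiff ℂ ω fun (z : Fin (n + 2) → ℂ) (j : Fin n) => z j.succ.succ :=
    contDiff_pi.2 fun j => contDiff_apply ℂ ℂ j.succ.succ
  exact contMDiff_of_subtype_val fun _ => contMDiffAt_comp_subtype_val h.contDiffAt

theorem contMDiffAt_consU {C : TriangulatedConfiguration E n} {F H M : Type*}
    [NormedAddCommGroup F] [NormedSpace ℂ F] [TopologicalSpace H] {I : ModelWithCorners ℂ F H}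
    [TopologicalSpace M] [ChartedSpace H M] {a b : M → ℂ} {w : M → C.U} {x : M}
    (ha : ContMDiffAt I 𝓘(ℂ, ℂ) ω a x) (hb : ContMDiffAt I 𝓘(ℂ, ℂ) ω b x)
    (hw : ContMDiffAt I 𝓘(ℂ, Fin n → ℂ) ω w x) (ha₀ : ∀ x, a x ≠ 0) (hb₀ : ∀ x, b x ≠ 0) :
    ContMDiffAt I 𝓘(ℂ, Fin (n + 2) → ℂ) ω (fun x => consU (a x) (b x) (ha₀ x) (hb₀ x) (w x)) x := by
  refine contMDiffAt_of_subtype_val (contMDiffAt_pi_space.2 fun j => ?_)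
  refine Fin.cases ha (fun j => ?_) j
  refine Fin.cases hb (fun j => ?_) j
  exact contMDiffAt_pi_space.1 (contMDiff_subtype_val.contMDiffAt.comp x hw) j

section Bundle

variable {C : TriangulatedConfiguration E n} {Λ : Matrix (Fin n) (Fin m) ℂ} {τ : ℍ}
  {l : Fin m → ℂ}

theorem toLVMB_consU_eq {a b a' b' : ℂ} {ha : a ≠ 0} {hb : b ≠ 0} {ha' : a' ≠ 0} {hb' : b' ≠ 0}
    {z w : C.U} (g : ℂ × (Fin m → ℂ)) (v : ℂ) (h1 : a' = expTwoPiI (weight l g + v) * a)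
    (h2 : b' = expTwoPiI (weight l g + τ * v) * b) (h3 : w = C.actU Λ g z) :
    C.prependTwoZeros.toLVMB (prependRows τ l Λ) (consU a b ha hb z) =
      C.prependTwoZeros.toLVMB (prependRows τ l Λ) (consU a' b' ha' hb' w) := by
  refine toLVMB_eq_iff.2 ⟨(g.1, Matrix.vecCons v g.2), funext fun j => ?_⟩
  rw [act_apply]
  refine Fin.cases ?_ (fun j => ?_) j
  · rw [exponent_prependRows_zero]
    exact h1
  · refine Fin.cases ?_ (fun j => ?_) j
    · rw [Fin.succ_zero_eq_one, exponent_prependRows_one]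
      exact h2
    · rw [exponent_prependRows_succ, h3]
      rfl

theorem exists_of_toLVMB_consU_eq {a b a' b' : ℂ} {ha : a ≠ 0} {hb : b ≠ 0} {ha' : a' ≠ 0}
    {hb' : b' ≠ 0} {z w : C.U}
    (h : C.prependTwoZeros.toLVMB (prependRows τ l Λ) (consU a b ha hb z) =
      C.prependTwoZeros.toLVMB (prependRows τ l Λ) (consU a' b' ha' hb' w)) :
    ∃ (g : ℂ × (Fin m → ℂ)) (v : ℂ), a' = expTwoPiI (weight l g + v) * a ∧
      b' = expTwoPiI (weight l g + τ * v) * b ∧ w = C.actU Λ g z := by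
  obtain ⟨g', hg⟩ := toLVMB_eq_iff.1 h
  obtain ⟨g, v, rfl⟩ := exists_eq_vecCons g'
  refine ⟨g, v, ?_, ?_, Subtype.ext (funext fun j => ?_)⟩
  · rw [← exponent_prependRows_zero τ l Λ]
    exact congrFun hg 0
  · rw [← exponent_prependRows_one τ l Λ]
    exact congrFun hg 1
  · have := congrFun hg j.succ.succ
    rw [act_apply, exponent_prependRows_succ] at this
    exact this

/-! ### The projection and the action of the elliptic curve -/

variable (C Λ τ l) in
/-- The projection `[(a, b, z)] ↦ [z]` between the LVMB manifolds. -/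
def bundleProj : C.prependTwoZeros.LVMB (prependRows τ l Λ) → C.LVMB Λ :=
  Quotient.lift (fun z => C.toLVMB Λ (tailU z)) fun z w h => by
    obtain ⟨a, b, ha, hb, z, rfl⟩ := exists_eq_consU z
    obtain ⟨a', b', ha', hb', w, rfl⟩ := exists_eq_consU w
    obtain ⟨g, v, -, -, hg⟩ := exists_of_toLVMB_consU_eq (Λ := Λ) (τ := τ) (l := l)
      (Quotient.sound h)
    exact toLVMB_eq_iff.2 ⟨g, congrArg Subtype.val hg⟩

@[simp]
theorem bundleProj_toLVMB (z : C.prependTwoZeros.U) :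
    bundleProj C Λ τ l (C.prependTwoZeros.toLVMB (prependRows τ l Λ) z) =
      C.toLVMB Λ (tailU z) := rfl

/-- The map `(a, b, z) ↦ (a, exp(2πit) b, z)`. -/
def shiftU (t : ℂ) (z : C.prependTwoZeros.U) : C.prependTwoZeros.U :=
  consU (z.1 0) (expTwoPiI t * z.1 1) (mem_U_prependTwoZeros.1 z.2).1
    (mul_ne_zero (expTwoPiI_ne_zero t) (mem_U_prependTwoZeros.1 z.2).2.1) (tailU z)

theorem shiftU_consU (t a b : ℂ) (ha : a ≠ 0) (hb : b ≠ 0) (z : C.U) :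
    shiftU t (consU a b ha hb z) =
      consU a (expTwoPiI t * b) ha (mul_ne_zero (expTwoPiI_ne_zero t) hb) z := rfl

variable (C Λ τ l) in
/-- The action of the elliptic curve: `t • [(a, b, z)] = [(a, exp(2πit) b, z)]`. -/
def ellipticVAdd (t : EllipticCurveOfPeriod τ)
    (q : C.prependTwoZeros.LVMB (prependRows τ l Λ)) :
    C.prependTwoZeros.LVMB (prependRows τ l Λ) :=
  Quotient.liftOn₂' t q
    (fun t z => C.prependTwoZeros.toLVMB (prependRows τ l Λ) (shiftU t z)) <| by
      intro t z t' w ht h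
      obtain ⟨a, b, ha, hb, z, rfl⟩ := exists_eq_consU z
      obtain ⟨a', b', ha', hb', w, rfl⟩ := exists_eq_consU w
      obtain ⟨g, v, h1, h2, h3⟩ := exists_of_toLVMB_consU_eq (Λ := Λ) (τ := τ) (l := l)
        (Quotient.sound h)
      obtain ⟨c, d, hcd⟩ := mk_eq_mk_iff.1
        (Quotient.sound' ht : (t : EllipticCurveOfPeriod τ) = t')
      simp only [shiftU_consU]
      -- a period `c + d τ` is compensated by adding `d` to the last group parameter
      refine toLVMB_consU_eq g (v + d) ?_ ?_ h3
      · rw [h1, ← add_assoc, expTwoPiI_add _ (d : ℂ), expTwoPiI_intCast, mul_one]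
      · rw [h2, hcd, ← mul_assoc, ← mul_assoc, ← expTwoPiI_add, ← expTwoPiI_add]
        congr 1
        exact expTwoPiI_eq_iff.2 ⟨c, by ring⟩

theorem ellipticVAdd_toLVMB (t : ℂ) (z : C.prependTwoZeros.U) :
    ellipticVAdd C Λ τ l t (C.prependTwoZeros.toLVMB (prependRows τ l Λ) z) =
      C.prependTwoZeros.toLVMB (prependRows τ l Λ) (shiftU t z) := rfl

variable (C Λ τ l) in
/-- The action of the elliptic curve on the enlarged LVMB manifold. -/
abbrev ellipticAddAction :
    AddAction (EllipticCurveOfPeriod τ) (C.prependTwoZeros.LVMB (prependRows τ l Λ)) where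
  vadd := ellipticVAdd C Λ τ l
  zero_vadd q := by
    obtain ⟨z, rfl⟩ := surjective_toLVMB _ _ q
    refine (ellipticVAdd_toLVMB 0 z).trans (congrArg _ ?_)
    conv_rhs => rw [← consU_tailU z]
    simp [shiftU]
  add_vadd s t q := by
    obtain ⟨s, rfl⟩ := QuotientAddGroup.mk_surjective s
    obtain ⟨t, rfl⟩ := QuotientAddGroup.mk_surjective t
    obtain ⟨z, rfl⟩ := surjective_toLVMB _ _ q
    change ellipticVAdd C Λ τ l (((s + t : ℂ)) : EllipticCurveOfPeriod τ) _ =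
      ellipticVAdd C Λ τ l s (ellipticVAdd C Λ τ l t _)
    rw [ellipticVAdd_toLVMB, ellipticVAdd_toLVMB, ellipticVAdd_toLVMB]
    obtain ⟨a, b, ha, hb, z, rfl⟩ := exists_eq_consU z
    simp only [shiftU_consU, expTwoPiI_add, mul_assoc]

theorem contMDiff_shiftU : ContMDiff (𝓘(ℂ, ℂ).prod 𝓘(ℂ, Fin (n + 2) → ℂ))
    𝓘(ℂ, Fin (n + 2) → ℂ) ω (fun x : ℂ × C.prependTwoZeros.U => shiftU x.1 x.2) := by
  intro x
  have hco : ∀ j, ContMDiffAt (𝓘(ℂ, ℂ).prod 𝓘(ℂ, Fin (n + 2) → ℂ)) 𝓘(ℂ, ℂ) ω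
      (fun x : ℂ × C.prependTwoZeros.U => x.2.1 j) x := fun j =>
    (contMDiffAt_comp_subtype_val (contDiff_apply ℂ ℂ j).contDiffAt).comp x contMDiffAt_snd
  refine contMDiffAt_consU (hco 0) (ContMDiffAt.mul
    (contDiff_expTwoPiI.contMDiff.contMDiffAt.comp x contMDiffAt_fst) (hco 1))
    (contMDiff_tailU.contMDiffAt.comp x contMDiffAt_snd) _ _

/-! ### Trivializations -/

variable (C Λ τ l) in
/-- The fibre coordinate defined by a function `χ` which transforms as the first two coordinates
do up to the action of the last group parameter. -/
def fibreCoord (χ : C.U → ℂ) (q : C.prependTwoZeros.LVMB (prependRows τ l Λ)) :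
    EllipticCurveOfPeriod τ :=
  let z := Function.surjInv (surjective_toLVMB C.prependTwoZeros (prependRows τ l Λ)) q
  ellipticLog τ (z.1 1 / χ (tailU z), z.1 0 / χ (tailU z))

variable (C Λ τ l) in
/-- The point `[(χ(z), χ(z) exp(2πit), z)]` over `[z]` with fibre coordinate `t`. -/
def fibrePoint (χ : C.U → ℂ) (hχ : ∀ z, χ z ≠ 0) (x : C.LVMB Λ × EllipticCurveOfPeriod τ) :
    C.prependTwoZeros.LVMB (prependRows τ l Λ) :=
  let z := Function.surjInv (surjective_toLVMB C Λ) x.1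
  let t := Function.surjInv QuotientAddGroup.mk_surjective x.2
  C.prependTwoZeros.toLVMB (prependRows τ l Λ)
    (consU (χ z) (χ z * expTwoPiI t) (hχ z) (mul_ne_zero (hχ z) (expTwoPiI_ne_zero t)) z)

variable {W : Set (C.LVMB Λ)} {χ : C.U → ℂ}

theorem fibreCoord_toLVMB (hχ : ∀ z, χ z ≠ 0)
    (heq : ∀ z, C.toLVMB Λ z ∈ W → ∀ g, χ (C.actU Λ g z) = expTwoPiI (weight l g) * χ z)
    {a b : ℂ} {ha : a ≠ 0} {hb : b ≠ 0} {z : C.U} (hz : C.toLVMB Λ z ∈ W) :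
    fibreCoord C Λ τ l χ (C.prependTwoZeros.toLVMB (prependRows τ l Λ) (consU a b ha hb z)) =
      ellipticLog τ (b / χ z, a / χ z) := by
  have hs := Function.surjInv_eq (surjective_toLVMB C.prependTwoZeros (prependRows τ l Λ))
    (C.prependTwoZeros.toLVMB (prependRows τ l Λ) (consU a b ha hb z))
  rw [fibreCoord]
  generalize Function.surjInv (surjective_toLVMB C.prependTwoZeros (prependRows τ l Λ))
    (C.prependTwoZeros.toLVMB (prependRows τ l Λ) (consU a b ha hb z)) = z' at hs ⊢
  obtain ⟨a', b', ha', hb', w, rfl⟩ := exists_eq_consU z'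
  obtain ⟨g, v, h1, h2, rfl⟩ := exists_of_toLVMB_consU_eq hs.symm
  have e1 := expTwoPiI_logTwoPiI (div_ne_zero hb (hχ z))
  have e2 := expTwoPiI_logTwoPiI (div_ne_zero ha (hχ z))
  have hw := hχ z
  rw [ellipticLog_eq τ (x := logTwoPiI (b / χ z) + τ * v) (y := logTwoPiI (a / χ z) + v)]
  · rw [ellipticLog]
    congr 1
    ring
  · change _ = b' / χ (C.actU Λ g z)
    have h3 := expTwoPiI_ne_zero (weight l g)
    rw [expTwoPiI_add, e1, heq z hz, h2, expTwoPiI_add]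
    field_simp
  · change _ = a' / χ (C.actU Λ g z)
    have h3 := expTwoPiI_ne_zero (weight l g)
    rw [expTwoPiI_add, e2, heq z hz, h1, expTwoPiI_add]
    field_simp

theorem fibrePoint_toLVMB (hχ : ∀ z, χ z ≠ 0)
    (heq : ∀ z, C.toLVMB Λ z ∈ W → ∀ g, χ (C.actU Λ g z) = expTwoPiI (weight l g) * χ z)
    {z : C.U} (hz : C.toLVMB Λ z ∈ W) (t : ℂ) :
    fibrePoint C Λ τ l χ hχ (C.toLVMB Λ z, (t : EllipticCurveOfPeriod τ)) =
      C.prependTwoZeros.toLVMB (prependRows τ l Λ) (consU (χ z) (χ z * expTwoPiI t) (hχ z)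
        (mul_ne_zero (hχ z) (expTwoPiI_ne_zero t)) z) := by
  rw [fibrePoint]
  have hs := Function.surjInv_eq (surjective_toLVMB C Λ) (C.toLVMB Λ z)
  have ht := Function.surjInv_eq QuotientAddGroup.mk_surjective (t : EllipticCurveOfPeriod τ)
  obtain ⟨g, hg⟩ := toLVMB_eq_iff.1 hs.symm
  have hg' : Function.surjInv (surjective_toLVMB C Λ) (C.toLVMB Λ z) = C.actU Λ g z :=
    Subtype.ext hg
  obtain ⟨c, d, hcd⟩ := mk_eq_mk_iff.1 ht.symm
  refine (toLVMB_consU_eq g d ?_ ?_ hg').symm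
  · rw [hg', heq z hz, expTwoPiI_add, expTwoPiI_intCast, mul_one]
  · rw [hg', heq z hz, hcd, mul_assoc, mul_left_comm, ← expTwoPiI_add, mul_left_comm,
      ← expTwoPiI_add]
    congr 1
    exact expTwoPiI_eq_iff.2 ⟨c, by ring⟩

theorem fibrePoint_fibreCoord (hχ : ∀ z, χ z ≠ 0)
    (heq : ∀ z, C.toLVMB Λ z ∈ W → ∀ g, χ (C.actU Λ g z) = expTwoPiI (weight l g) * χ z)
    {q : C.prependTwoZeros.LVMB (prependRows τ l Λ)} (hq : bundleProj C Λ τ l q ∈ W) :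
    fibrePoint C Λ τ l χ hχ (bundleProj C Λ τ l q, fibreCoord C Λ τ l χ q) = q := by
  obtain ⟨z, rfl⟩ := surjective_toLVMB _ _ q
  obtain ⟨a, b, ha, hb, z, rfl⟩ := exists_eq_consU z
  rw [bundleProj_toLVMB, tailU_consU] at hq ⊢
  have e1 := expTwoPiI_logTwoPiI (div_ne_zero hb (hχ z))
  have e2 := expTwoPiI_logTwoPiI (div_ne_zero ha (hχ z))
  have hw := hχ z
  rw [fibreCoord_toLVMB hχ heq hq, ellipticLog, fibrePoint_toLVMB hχ heq hq]
  refine toLVMB_consU_eq 0 (logTwoPiI (a / χ z)) ?_ ?_ ?_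
  · rw [map_zero, zero_add, e2, div_mul_cancel₀ _ hw]
  · rw [map_zero, zero_add, mul_left_comm, ← expTwoPiI_add, add_sub_cancel]
    simp only
    rw [e1, mul_div_cancel₀ _ hw]
  · exact Subtype.ext (act_zero _ _).symm

theorem bundleProj_fibrePoint (hχ : ∀ z, χ z ≠ 0) (x : C.LVMB Λ × EllipticCurveOfPeriod τ) :
    bundleProj C Λ τ l (fibrePoint C Λ τ l χ hχ x) = x.1 :=
  Function.surjInv_eq (surjective_toLVMB C Λ) x.1

theorem fibreCoord_fibrePoint (hχ : ∀ z, χ z ≠ 0)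
    (heq : ∀ z, C.toLVMB Λ z ∈ W → ∀ g, χ (C.actU Λ g z) = expTwoPiI (weight l g) * χ z)
    {x : C.LVMB Λ × EllipticCurveOfPeriod τ} (hx : x.1 ∈ W) :
    fibreCoord C Λ τ l χ (fibrePoint C Λ τ l χ hχ x) = x.2 := by
  obtain ⟨q, t⟩ := x
  obtain ⟨z, rfl⟩ := surjective_toLVMB _ _ q
  obtain ⟨t, rfl⟩ := QuotientAddGroup.mk_surjective t
  rw [fibrePoint_toLVMB hχ heq hx, fibreCoord_toLVMB hχ heq hx,
    ellipticLog_eq τ (x := t) (y := 0)]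
  · simp
  · rw [mul_div_cancel_left₀ _ (hχ z)]
  · rw [expTwoPiI_zero, div_self (hχ z)]

theorem fibreCoord_ellipticVAdd (hχ : ∀ z, χ z ≠ 0)
    (heq : ∀ z, C.toLVMB Λ z ∈ W → ∀ g, χ (C.actU Λ g z) = expTwoPiI (weight l g) * χ z)
    {q : C.prependTwoZeros.LVMB (prependRows τ l Λ)} (hq : bundleProj C Λ τ l q ∈ W)
    (t : EllipticCurveOfPeriod τ) :
    fibreCoord C Λ τ l χ (ellipticVAdd C Λ τ l t q) = t + fibreCoord C Λ τ l χ q := by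
  obtain ⟨z, rfl⟩ := surjective_toLVMB _ _ q
  obtain ⟨t, rfl⟩ := QuotientAddGroup.mk_surjective t
  obtain ⟨a, b, ha, hb, z, rfl⟩ := exists_eq_consU z
  have e1 := expTwoPiI_logTwoPiI (div_ne_zero hb (hχ z))
  have e2 := expTwoPiI_logTwoPiI (div_ne_zero ha (hχ z))
  replace hq : C.toLVMB Λ z ∈ W := hq
  rw [ellipticVAdd_toLVMB, shiftU_consU, fibreCoord_toLVMB hχ heq hq,
    fibreCoord_toLVMB hχ heq hq, ellipticLog_eq τ (x := t + logTwoPiI (b / χ z))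
      (y := logTwoPiI (a / χ z)), ellipticLog, ← QuotientAddGroup.mk_add]
  · congr 1
    ring
  · rw [expTwoPiI_add, e1, mul_div_assoc]
  · rw [e2]

end Bundle

section Bundle

variable {C : TriangulatedConfiguration E n} {Λ : Matrix (Fin n) (Fin m) ℂ} {τ : ℍ}
  {l : Fin m → ℂ} {k k' : ℕ} [cN : ChartedSpace (Fin k → ℂ) (C.LVMB Λ)]
  [cN' : ChartedSpace (Fin k' → ℂ) (C.prependTwoZeros.LVMB (prependRows τ l Λ))]
  {W : Set (C.LVMB Λ)} {χ : C.U → ℂ}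

/-! ### Holomorphy of the bundle -/

theorem contMDiff_bundleProj (hN : C.IsComplexStructure Λ cN)
    (hN' : C.prependTwoZeros.IsComplexStructure (prependRows τ l Λ) cN') :
    ContMDiff 𝓘(ℂ, Fin k' → ℂ) 𝓘(ℂ, Fin k → ℂ) ω (bundleProj C Λ τ l) := fun _ =>
  hN'.hasLocalSections.contMDiffAt fun z _ =>
    (hN.contMDiff_toLVMB.comp contMDiff_tailU).contMDiffAt (x := z)

theorem contMDiff_ellipticVAdd
    (hN' : C.prependTwoZeros.IsComplexStructure (prependRows τ l Λ) cN') :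
    ContMDiff (𝓘(ℂ, ℂ).prod 𝓘(ℂ, Fin k' → ℂ)) 𝓘(ℂ, Fin k' → ℂ) ω
      (fun x : EllipticCurveOfPeriod τ × C.prependTwoZeros.LVMB (prependRows τ l Λ) =>
        ellipticVAdd C Λ τ l x.1 x.2) := fun _ =>
  ((hasLocalSections_mk τ).prodMap hN'.hasLocalSections).contMDiffAt fun z _ =>
    (hN'.contMDiff_toLVMB.comp contMDiff_shiftU).contMDiffAt (x := z)

theorem contMDiffAt_fibreCoord
    (hN' : C.prependTwoZeros.IsComplexStructure (prependRows τ l Λ) cN') (hW : IsOpen W)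
    (hχ : ∀ z, χ z ≠ 0)
    (hχs : ∀ z, C.toLVMB Λ z ∈ W → ContMDiffAt 𝓘(ℂ, Fin n → ℂ) 𝓘(ℂ, ℂ) ω χ z)
    (heq : ∀ z, C.toLVMB Λ z ∈ W → ∀ g, χ (C.actU Λ g z) = expTwoPiI (weight l g) * χ z)
    {q : C.prependTwoZeros.LVMB (prependRows τ l Λ)} (hq : bundleProj C Λ τ l q ∈ W) :
    ContMDiffAt 𝓘(ℂ, Fin k' → ℂ) 𝓘(ℂ, ℂ) ω (fibreCoord C Λ τ l χ) q := by
  refine hN'.hasLocalSections.contMDiffAt ?_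
  rintro z rfl
  have hz : C.toLVMB Λ (tailU z) ∈ W := hq
  have hco : ∀ j, ContMDiffAt 𝓘(ℂ, Fin (n + 2) → ℂ) 𝓘(ℂ, ℂ) ω
      (fun z : C.prependTwoZeros.U => z.1 j) z := fun j =>
    contMDiffAt_comp_subtype_val (contDiff_apply ℂ ℂ j).contDiffAt
  have hχt : ContMDiffAt 𝓘(ℂ, Fin (n + 2) → ℂ) 𝓘(ℂ, ℂ) ω
      (fun z : C.prependTwoZeros.U => χ (tailU z)) z :=
    (hχs _ hz).comp z contMDiff_tailU.contMDiffAt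
  have h1 := (contMDiffAt_ellipticLog τ
    (p := (z.1 1 / χ (tailU z), z.1 0 / χ (tailU z)))
    (div_ne_zero (mem_U_prependTwoZeros.1 z.2).2.1 (hχ _))
    (div_ne_zero (mem_U_prependTwoZeros.1 z.2).1 (hχ _))).comp z
    (((hco 1).div₀ hχt (hχ _)).prodMk_space ((hco 0).div₀ hχt (hχ _)))
  refine h1.congr_of_eventuallyEq ?_
  have hcont : Continuous fun z : C.prependTwoZeros.U => C.toLVMB Λ (tailU z) :=
    (C.continuous_toLVMB Λ).comp contMDiff_tailU.continuous
  filter_upwards [hcont.continuousAt.preimage_mem_nhds (hW.mem_nhds hz)] with w hw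
  conv_lhs => rw [← consU_tailU w]
  exact fibreCoord_toLVMB hχ heq hw

theorem contMDiffAt_fibrePoint (hN : C.IsComplexStructure Λ cN)
    (hN' : C.prependTwoZeros.IsComplexStructure (prependRows τ l Λ) cN') (hW : IsOpen W)
    (hχ : ∀ z, χ z ≠ 0)
    (hχs : ∀ z, C.toLVMB Λ z ∈ W → ContMDiffAt 𝓘(ℂ, Fin n → ℂ) 𝓘(ℂ, ℂ) ω χ z)
    (heq : ∀ z, C.toLVMB Λ z ∈ W → ∀ g, χ (C.actU Λ g z) = expTwoPiI (weight l g) * χ z)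
    {x : C.LVMB Λ × EllipticCurveOfPeriod τ} (hx : x.1 ∈ W) :
    ContMDiffAt (𝓘(ℂ, Fin k → ℂ).prod 𝓘(ℂ, ℂ)) 𝓘(ℂ, Fin k' → ℂ) ω
      (fibrePoint C Λ τ l χ hχ) x := by
  refine (hN.hasLocalSections.prodMap (hasLocalSections_mk τ)).contMDiffAt ?_
  rintro z rfl
  have hz : C.toLVMB Λ z.1 ∈ W := hx
  have h0 : ContMDiffAt (𝓘(ℂ, Fin n → ℂ).prod 𝓘(ℂ, ℂ)) 𝓘(ℂ, ℂ) ω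
      (fun z : C.U × ℂ => χ z.1) z := (hχs _ hz).comp z contMDiffAt_fst
  have h1 : ContMDiffAt (𝓘(ℂ, Fin n → ℂ).prod 𝓘(ℂ, ℂ)) 𝓘(ℂ, ℂ) ω
      (fun z : C.U × ℂ => χ z.1 * expTwoPiI z.2) z :=
    h0.mul (contDiff_expTwoPiI.contMDiff.contMDiffAt.comp z contMDiffAt_snd)
  have h2 := hN'.contMDiff_toLVMB.contMDiffAt.comp z (contMDiffAt_consU h0 h1 contMDiffAt_fst
    (fun z => hχ z.1) fun z => mul_ne_zero (hχ z.1) (expTwoPiI_ne_zero z.2))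
  refine h2.congr_of_eventuallyEq ?_
  filter_upwards [((C.continuous_toLVMB Λ).comp continuous_fst).continuousAt.preimage_mem_nhds
    (hW.mem_nhds hz)] with w hw
  exact fibrePoint_toLVMB hχ heq hw w.2

/-- A nonvanishing holomorphic function over `W` transforming as the first two coordinates do up to
the last group parameter defines a trivialization over `W`. -/
theorem exists_trivialization (hN : C.IsComplexStructure Λ cN)
    (hN' : C.prependTwoZeros.IsComplexStructure (prependRows τ l Λ) cN') (hW : IsOpen W)
    (hχ : ∀ z, χ z ≠ 0)
    (hχs : ∀ z, C.toLVMB Λ z ∈ W → ContMDiffAt 𝓘(ℂ, Fin n → ℂ) 𝓘(ℂ, ℂ) ω χ z)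
    (heq : ∀ z, C.toLVMB Λ z ∈ W → ∀ g, χ (C.actU Λ g z) = expTwoPiI (weight l g) * χ z) :
    ∃ e : Bundle.Trivialization (EllipticCurveOfPeriod τ) (bundleProj C Λ τ l), e.baseSet = W ∧
      ContMDiffOn 𝓘(ℂ, Fin k' → ℂ) (𝓘(ℂ, Fin k → ℂ).prod 𝓘(ℂ, ℂ)) ω e e.source ∧
      ContMDiffOn (𝓘(ℂ, Fin k → ℂ).prod 𝓘(ℂ, ℂ)) 𝓘(ℂ, Fin k' → ℂ) ω
        e.toOpenPartialHomeomorph.symm e.target ∧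
      ∀ (t : EllipticCurveOfPeriod τ) x, x ∈ e.source →
        e (ellipticVAdd C Λ τ l t x) = ((e x).1, t + (e x).2) := by
  have h1 : ContMDiffOn 𝓘(ℂ, Fin k' → ℂ) (𝓘(ℂ, Fin k → ℂ).prod 𝓘(ℂ, ℂ)) ω
      (fun q => (bundleProj C Λ τ l q, fibreCoord C Λ τ l χ q)) (bundleProj C Λ τ l ⁻¹' W) :=
    fun q hq => ((contMDiff_bundleProj hN hN').contMDiffAt.prodMk
      (contMDiffAt_fibreCoord hN' hW hχ hχs heq hq)).contMDiffWithinAt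
  have h2 : ContMDiffOn (𝓘(ℂ, Fin k → ℂ).prod 𝓘(ℂ, ℂ)) 𝓘(ℂ, Fin k' → ℂ) ω
      (fibrePoint C Λ τ l χ hχ) (W ×ˢ Set.univ) := fun x hx =>
    (contMDiffAt_fibrePoint hN hN' hW hχ hχs heq hx.1).contMDiffWithinAt
  refine ⟨{
    toFun := fun q => (bundleProj C Λ τ l q, fibreCoord C Λ τ l χ q)
    invFun := fibrePoint C Λ τ l χ hχ
    source := bundleProj C Λ τ l ⁻¹' W
    target := W ×ˢ Set.univ
    map_source' := fun q hq => ⟨hq, trivial⟩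
    map_target' := fun x hx => by
      rw [Set.mem_preimage, bundleProj_fibrePoint (l := l)]
      exact hx.1
    left_inv' := fun q hq => fibrePoint_fibreCoord hχ heq hq
    right_inv' := fun x hx => Prod.ext (bundleProj_fibrePoint (l := l) hχ x)
      (fibreCoord_fibrePoint hχ heq hx.1)
    open_source := hW.preimage (contMDiff_bundleProj hN hN').continuous
    open_target := hW.prod isOpen_univ
    continuousOn_toFun := h1.continuousOn
    continuousOn_invFun := h2.continuousOn
    baseSet := W
    open_baseSet := hW
    source_eq := rfl
    target_eq := rfl
    proj_toFun := fun _ _ => rfl }, rfl, h1, h2, fun t q hq => ?_⟩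
  refine Prod.ext ?_ (fibreCoord_ellipticVAdd hχ heq hq t)
  obtain ⟨z, rfl⟩ := surjective_toLVMB _ _ q
  obtain ⟨t, rfl⟩ := QuotientAddGroup.mk_surjective t
  rfl

/-- If the function is defined everywhere, the bundle is trivial. -/
theorem nonempty_diffeomorph (hN : C.IsComplexStructure Λ cN)
    (hN' : C.prependTwoZeros.IsComplexStructure (prependRows τ l Λ) cN') (hχ : ∀ z, χ z ≠ 0)
    (hχs : ∀ z, ContMDiffAt 𝓘(ℂ, Fin n → ℂ) 𝓘(ℂ, ℂ) ω χ z)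
    (heq : ∀ z g, χ (C.actU Λ g z) = expTwoPiI (weight l g) * χ z) :
    Nonempty (Diffeomorph 𝓘(ℂ, Fin k' → ℂ) (𝓘(ℂ, Fin k → ℂ).prod 𝓘(ℂ, ℂ))
      (C.prependTwoZeros.LVMB (prependRows τ l Λ)) (C.LVMB Λ × EllipticCurveOfPeriod τ) ω) :=
  ⟨{
    toFun := fun q => (bundleProj C Λ τ l q, fibreCoord C Λ τ l χ q)
    invFun := fibrePoint C Λ τ l χ hχ
    left_inv := fun _ => fibrePoint_fibreCoord (W := Set.univ) hχ (fun z _ => heq z) trivial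
    right_inv := fun x => Prod.ext (bundleProj_fibrePoint (l := l) hχ x)
      (fibreCoord_fibrePoint (W := Set.univ) hχ (fun z _ => heq z) trivial)
    contMDiff_toFun := fun _ => (contMDiff_bundleProj hN hN').contMDiffAt.prodMk
      (contMDiffAt_fibreCoord hN' isOpen_univ hχ (fun z _ => hχs z) (fun z _ => heq z) trivial)
    contMDiff_invFun := fun _ => contMDiffAt_fibrePoint hN hN' isOpen_univ hχ (fun z _ => hχs z)
      (fun z _ => heq z) trivial }⟩

theorem isHolomorphicPrincipalBundle (h : C.IsAdmissible Λ)
    (hn : n = Module.finrank ℝ E + (2 * m + 1)) (hN : C.IsComplexStructure Λ cN)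
    (hN' : C.prependTwoZeros.IsComplexStructure (prependRows τ l Λ) cN') :
    let _ := ellipticAddAction C Λ τ l
    IsHolomorphicPrincipalBundle (EllipticCurveOfPeriod τ) k' k (bundleProj C Λ τ l) := by
  let := ellipticAddAction C Λ τ l
  refine ⟨contMDiff_bundleProj hN hN', contMDiff_ellipticVAdd hN', fun t q => ?_, fun y => ?_⟩
  · obtain ⟨z, rfl⟩ := surjective_toLVMB _ _ q
    obtain ⟨t, rfl⟩ := QuotientAddGroup.mk_surjective t
    rfl
  · obtain ⟨W, χ, hW, hy, hχ, hχs, heq⟩ := h.exists_equivariant hn l y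
    obtain ⟨e, he, h1, h2, h3⟩ := exists_trivialization (τ := τ) hN hN' hW hχ hχs heq
    exact ⟨e, he ▸ hy, h1, h2, h3⟩

end Bundle

/-! ### Gale dual configurations and period matrices -/

theorem _root_.eq_zero_of_im_dotProduct_eq_zero {Per : Matrix (Fin m) (Fin m ⊕ Fin m) ℂ}
    (hPer : IsPeriodMatrix Per) {u : Fin m → ℂ}
    (hu : ∀ k, ((fun i => Per i k) ⬝ᵥ u).im = 0) : u = 0 := by
  have hspan : Submodule.span ℝ (Set.range fun k i => Per i k) = ⊤ :=
    LinearIndependent.span_eq_top_of_card_eq_finrank' hPer (by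
      rw [Module.finrank_pi_fintype]
      simp [Complex.finrank_real_complex]
      ring)
  have hall : ∀ w : Fin m → ℂ, (w ⬝ᵥ u).im = 0 := by
    intro w
    have hw : w ∈ Submodule.span ℝ (Set.range fun k i => Per i k) := hspan ▸ Submodule.mem_top
    induction hw using Submodule.span_induction with
    | mem x hx =>
      obtain ⟨k, rfl⟩ := hx
      exact hu k
    | zero => simp
    | add x y _ _ hx hy => rw [add_dotProduct, Complex.add_im, hx, hy, add_zero]
    | smul a x _ hx => rw [smul_dotProduct, Complex.smul_im, hx, smul_zero]
  ext i
  have h1 := hall (Pi.single i 1)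
  have h2 := hall (Pi.single i Complex.I)
  rw [single_dotProduct] at h1 h2
  exact Complex.ext (by simpa using h2) (by simpa using h1)

theorem im_exponent_complexPoints (Λ : Matrix (Fin n) (Fin m ⊕ Fin m) ℝ)
    (Per : Matrix (Fin m) (Fin m ⊕ Fin m) ℂ) (g : ℂ × (Fin m → ℂ)) (j : Fin n) :
    (exponent (complexPoints Λ Per) g j).im =
      g.1.im + ∑ k, ((fun i => Per i k) ⬝ᵥ g.2).im * Λ j k := by
  have h : complexPoints Λ Per j ⬝ᵥ g.2 = ∑ k, (Λ j k : ℂ) * ((fun i => Per i k) ⬝ᵥ g.2) := by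
    rw [complexPoints, Matrix.mul_apply_eq_vecMul, ← Matrix.dotProduct_mulVec]
    rfl
  rw [exponent_apply, h, Complex.add_im, Complex.im_sum]
  congr 1
  refine Finset.sum_congr rfl fun k _ => ?_
  rw [Complex.im_ofReal_mul, mul_comm]

theorem IsGaleDual.isAdmissible {C : TriangulatedConfiguration E n}
    {Λ : Matrix (Fin n) (Fin m ⊕ Fin m) ℝ} (hΛ : C.IsGaleDual Λ)
    {Per : Matrix (Fin m) (Fin m ⊕ Fin m) ℂ} (hPer : IsPeriodMatrix Per) :
    C.IsAdmissible (complexPoints Λ Per) := by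
  obtain ⟨hli, hspan⟩ := hΛ
  set f : Option (Fin m ⊕ Fin m) → Fin n → ℝ :=
    fun o => o.elim (fun _ => 1) (fun k j => Λ j k) with hf
  have hsum : ∀ c : Option (Fin m ⊕ Fin m) → ℝ, ∀ j,
      (∑ o, c o • f o) j = c none + ∑ k, c (some k) * Λ j k := fun c j => by
    rw [Fintype.sum_option]
    simp [hf]
  have him : ∀ g, (fun j => (exponent (complexPoints Λ Per) g j).im) =
      ∑ o, (fun o : Option (Fin m ⊕ Fin m) =>
        o.elim g.1.im fun k => ((fun i => Per i k) ⬝ᵥ g.2).im) o • f o := fun g => by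
    ext j
    rw [hsum, im_exponent_complexPoints]
    rfl
  -- the real isomorphism `u ↦ Im (Πᵀ u)`
  set T : (Fin m → ℂ) →ₗ[ℝ] (Fin m ⊕ Fin m → ℝ) := LinearMap.pi fun k =>
    Complex.imLm ∘ₗ (dotProductBilin ℝ ℂ (fun i => Per i k)) with hT
  have hTa : ∀ u k, T u k = ((fun i => Per i k) ⬝ᵥ u).im := fun u k => rfl
  have hsurj : Function.Surjective T := by
    refine (LinearMap.injective_iff_surjective_of_finrank_eq_finrank ?_).1 ?_
    · rw [Module.finrank_pi_fintype]
      simp [Complex.finrank_real_complex]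
      ring
    · rw [← LinearMap.ker_eq_bot, LinearMap.ker_eq_bot']
      intro u hu
      exact eq_zero_of_im_dotProduct_eq_zero hPer fun k => by rw [← hTa, hu]; rfl
  refine ⟨fun g => ?_, fun r hr => ?_, fun g hg => ?_⟩
  · rw [him, ← hspan]
    exact sum_mem fun o _ => Submodule.smul_mem _ _ (Submodule.subset_span ⟨o, rfl⟩)
  · rw [← hspan] at hr
    obtain ⟨c, rfl⟩ := (Submodule.mem_span_range_iff_exists_fun ℝ).1 hr
    obtain ⟨u, hu⟩ := hsurj fun k => c (some k)
    refine ⟨(c none * Complex.I, u), fun j => ?_⟩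
    rw [hsum, im_exponent_complexPoints]
    congr 1
    · simp
    · exact Finset.sum_congr rfl fun k _ => by rw [← hTa, hu]
  · have h0 := Fintype.linearIndependent_iff.1 hli _ ((him g).symm.trans (funext hg))
    exact ⟨h0 none, eq_zero_of_im_dotProduct_eq_zero hPer fun k => h0 (some k)⟩

/-- The real and imaginary parts of admissible exponents form a Gale dual configuration. -/
theorem IsAdmissible.isGaleDual {C : TriangulatedConfiguration E n}
    {Λ : Matrix (Fin n) (Fin m) ℂ} (h : C.IsAdmissible Λ) :
    C.IsGaleDual (Matrix.fromCols (Λ.map Complex.im) (Λ.map Complex.re)) := by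
  have key : ∀ (c : Option (Fin m ⊕ Fin m) → ℝ) (g : ℂ × (Fin m → ℂ)), g.1.im = c none →
      (∀ k, (g.2 k).re = c (some (Sum.inl k))) → (∀ k, (g.2 k).im = c (some (Sum.inr k))) →
      ∑ o, c o • (fun o : Option (Fin m ⊕ Fin m) => o.elim (fun _ => (1 : ℝ)) fun k j =>
        Matrix.fromCols (Λ.map Complex.im) (Λ.map Complex.re) j k) o =
      fun j => (exponent Λ g j).im := by
    intro c g h1 h2 h3
    ext j
    rw [Fintype.sum_option, Fintype.sum_sum_type, exponent_apply, Complex.add_im, h1, dotProduct,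
      Complex.im_sum]
    simp only [Complex.mul_im, h2, h3, Finset.sum_add_distrib]
    simp [mul_comm, add_comm]
  constructor
  · rw [Fintype.linearIndependent_iff]
    intro c hc
    set g : ℂ × (Fin m → ℂ) :=
      (⟨0, c none⟩, fun k => ⟨c (some (Sum.inl k)), c (some (Sum.inr k))⟩) with hg
    rw [key c g rfl (fun _ => rfl) fun _ => rfl] at hc
    obtain ⟨h1, h2⟩ := h.eq_zero g fun j => congrFun hc j
    rintro (_ | k | k)
    · exact h1
    · exact congrArg Complex.re (congrFun h2 k)
    · exact congrArg Complex.im (congrFun h2 k)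
  · ext r
    rw [Submodule.mem_span_range_iff_exists_fun]
    constructor
    · rintro ⟨c, rfl⟩
      rw [key c (⟨0, c none⟩, fun k => ⟨c (some (Sum.inl k)), c (some (Sum.inr k))⟩) rfl
        (fun _ => rfl) fun _ => rfl]
      exact h.im_mem _
    · intro hr
      obtain ⟨g, hg⟩ := h.exists_im_eq r hr
      refine ⟨fun o => o.elim g.1.im (Sum.elim (fun k => (g.2 k).re) fun k => (g.2 k).im), ?_⟩
      rw [key _ g rfl (fun _ => rfl) fun _ => rfl]
      exact funext hg

theorem _root_.isNormalizedPeriodMatrix_fromCols :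
    IsNormalizedPeriodMatrix (Matrix.fromCols (Complex.I • 1 : Matrix (Fin m) (Fin m) ℂ) 1) := by
  refine ⟨_, ?_, rfl⟩
  have h : (Complex.I • 1 : Matrix (Fin m) (Fin m) ℂ).map Complex.im = 1 := by
    ext i j
    by_cases hij : i = j <;> simp [Matrix.one_apply, hij]
  rw [h, Matrix.det_one]
  exact one_ne_zero

theorem _root_.complexPoints_fromCols (Λ : Matrix (Fin n) (Fin m) ℂ) :
    complexPoints (Matrix.fromCols (Λ.map Complex.im) (Λ.map Complex.re))
      (Matrix.fromCols (Complex.I • 1 : Matrix (Fin m) (Fin m) ℂ) 1) = Λ := by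
  ext j k
  rw [complexPoints, Matrix.mul_apply, Fintype.sum_sum_type]
  simp [Matrix.one_apply, add_comm]

end TriangulatedConfiguration

end

theorem mainTheorem11 {E : Type*} [AddCommGroup E] [Module ℝ E] [FiniteDimensional ℝ E] {n m : ℕ}
    (C : TriangulatedConfiguration E n) (hreg : C.IsRegular)
    (hodd : n = Module.finrank ℝ E + (2 * m + 1)) (hbal : C.IsBalanced)
    (Λ : Matrix (Fin n) (Fin m ⊕ Fin m) ℝ) (hΛ : C.IsGaleDual Λ)
    (Per : Matrix (Fin m) (Fin m ⊕ Fin m) ℂ) (hPer : IsPeriodMatrix Per) :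
    ∃ cN : ChartedSpace (Fin (Module.finrank ℝ E + m) → ℂ) (C.LVMB (complexPoints Λ Per)),
      C.IsComplexStructure (complexPoints Λ Per) cN ∧
      ∀ τ : UpperHalfPlane,
        ∃ (Λ' : Matrix (Fin (n + 2)) (Fin (m + 1) ⊕ Fin (m + 1)) ℝ)
          (Per' : Matrix (Fin (m + 1)) (Fin (m + 1) ⊕ Fin (m + 1)) ℂ),
          C.prependTwoZeros.IsGaleDual Λ' ∧ IsNormalizedPeriodMatrix Per' ∧
          ∃ cN' : ChartedSpace (Fin (Module.finrank ℝ E + (m + 1)) → ℂ)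
              (C.prependTwoZeros.LVMB (complexPoints Λ' Per')),
            C.prependTwoZeros.IsComplexStructure (complexPoints Λ' Per') cN' ∧
            (∃ (_ : AddAction (EllipticCurveOfPeriod τ)
                  (C.prependTwoZeros.LVMB (complexPoints Λ' Per')))
                (p : C.prependTwoZeros.LVMB (complexPoints Λ' Per') →
                  C.LVMB (complexPoints Λ Per)),
                IsHolomorphicPrincipalBundle (EllipticCurveOfPeriod τ)
                  (Module.finrank ℝ E + (m + 1)) (Module.finrank ℝ E + m) p) ∧
            ((∃ j, C.IsGhost j) →
              Nonempty (Diffeomorph 𝓘(ℂ, Fin (Module.finrank ℝ E + (m + 1)) → ℂ)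
                (𝓘(ℂ, Fin (Module.finrank ℝ E + m) → ℂ).prod 𝓘(ℂ, ℂ))
                (C.prependTwoZeros.LVMB (complexPoints Λ' Per'))
                (C.LVMB (complexPoints Λ Per) × EllipticCurveOfPeriod τ) ω)) := by
  have h := hΛ.isAdmissible hPer
  obtain ⟨cN, hN⟩ := h.exists_isComplexStructure hodd hbal
  refine ⟨cN, hN, fun τ => ?_⟩
  -- the rows of the new ghost vectors are shifted by the row of an old ghost vector, if any
  obtain ⟨l, hl⟩ : ∃ l : Fin m → ℂ, (∃ j, C.IsGhost j) →
      ∃ j, C.IsGhost j ∧ l = complexPoints Λ Per j := by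
    by_cases hg : ∃ j, C.IsGhost j
    · obtain ⟨j, hj⟩ := hg
      exact ⟨_, fun _ => ⟨j, hj, rfl⟩⟩
    · exact ⟨0, fun hg' => absurd hg' hg⟩
  have h' := h.prependTwoZeros τ l
  have hbal' : C.prependTwoZeros.IsBalanced := by
    have h0 : ∑ j, C.v j = 0 := hbal
    change ∑ j, C.prependTwoZeros.v j = 0
    simp [TriangulatedConfiguration.prependTwoZeros, Fin.sum_univ_succ, h0]
  obtain ⟨cN', hN'⟩ := h'.exists_isComplexStructure (by omega) hbal'
  refine ⟨_, _, h'.isGaleDual, isNormalizedPeriodMatrix_fromCols, ?_⟩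
  rw [complexPoints_fromCols]
  refine ⟨cN', hN', ⟨TriangulatedConfiguration.ellipticAddAction _ _ _ _, TriangulatedConfiguration.bundleProj _ _ _ _,
    TriangulatedConfiguration.isHolomorphicPrincipalBundle h hodd hN hN'⟩, fun hg => ?_⟩
  obtain ⟨j, hj, rfl⟩ := hl hg
  refine TriangulatedConfiguration.nonempty_diffeomorph (χ := fun z => z.1 j) hN hN' (fun z => ?_)
    (fun z => TriangulatedConfiguration.contMDiffAt_comp_subtype_val (contDiff_apply ℂ ℂ j).contDiffAt) fun z g => rfl
  obtain ⟨σ, hσ, -, hz⟩ := TriangulatedConfiguration.mem_U_iff.1 z.2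
  exact hz j (hj σ hσ)
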